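/- Let $\Omega=\{x\in\mathbb R^2:|x|<1\}$ be the unit disc. Let $\gamma\in\mathbb R$ and $\mu,\hat\mu\in\mathbb C$ with $\mu\ne\hat\mu$, and put $L=-\Delta$, $\widehat L=-\Delta+\gamma$. Let $H^{-1/2}(\partial\Omega)$ be the space of bounded antilinear functionals on $H^{1/2}(\partial\Omega)$, with pairing $\langle\!\langle\cdot,\cdot\rangle\!\rangle$. Let $\mathcal J\colon H^{1/2}(\partial\Omega)\to H^{-1/2}(\partial\Omega)$ be the inclusion, $\langle\!\langle \mathcal Jf,g\rangle\!\rangle=\int_{\partial\Omega} f\,\overline g\,ds$, and put $\Theta=\mu\mathcal J$, $\widehat\Theta=\hat\mu\mathcal J$. Write $\gamma_D$ for the Dirichlet trace and $\gamma_N$ for the conormal derivative, which here is the (weak) outward normal derivative. Let $\mathcal L^{\Theta}$ be the realization of $L$ in $L^2(\Omega)$ with boundary condition $\gamma_N u+\Theta\gamma_D u=0$, and let $\widehat{\mathcal L}^D$ be the Dirichlet realization of $\widehat L$. Let $\lambda$ be a real number with $\lambda>\max\{\gamma,0\}$ that lies in the resolvent sets of both $\mathcal L^{\Theta}$ and $\widehat{\mathcal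 L}^D$. Then the Robin-to-Dirichlet operator $$N_\Theta(\lambda)\colon H^{-1/2}(\partial\Omega)\to H^{1/2}(\partial\Omega),\qquad g\mapsto\gamma_D u,$$ where $u\in H^1(\Omega)$ solves $Lu=\lambda u$ in $\Omega$, $\gamma_N u+\Theta\gamma_D u=g$ on $\partial\Omega$, and the Dirichlet-to-Robin operator $$\widehat M_{\widehat\Theta}(\lambda)\colon H^{1/2}(\partial\Omega)\to H^{-1/2}(\partial\Omega),\qquad f\mapsto\gamma_N u+\widehat\Theta\gamma_D u,$$ where $u\in H^1(\Omega)$ solves $\widehat Lu=\lambda u$ in $\Omega$, $\gamma_D u=f$ on $\partial\Omega$, are well-defined bounded operators. Moreover, for $E(\lambda)=\widehat M_{\widehat\Theta}(\lambda)N_\Theta(\lambda)$ and every real $p>0$, the operator $E(\lambda)-I$ belongs to the Schatten–von Neumann class $\mathcal B_p\big(H^{-1/2}(\partial\Omega)\big)$ (the compact operators whose singular values $s_1,s_2,\dots$ satisfy $\sum_k s_k^p<\infty$) if and only if $p>1$. -/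

import Mathlib

open MeasureTheory Filter Topology
open scoped ENNReal ContDiff ComplexConjugate

noncomputable section

namespace DiscRobin

/-! ### The unit disc and the Sobolev space `H¹`

The plane `ℝ²` is written as `ℂ` with its real structure and Lebesgue measure; all functions are
complex valued.  Inner products are those of Mathlib, antilinear in the first argument, so the
inner product `⟨u, v⟩` that is linear in `u` is `inner ℂ v u`. -/

/-- The open unit disc. -/
def disc : Set ℂ := Metric.ball 0 1

/-- `L²(Ω)` for the unit disc `Ω`. -/
abbrev L2Disc : Type := Lp ℂ 2 ((volume : Measure ℂ).restrict disc)

/-- The partial derivative `∂ⱼ φ`: in the direction `1` for `j = 0`, in the direction `i` for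
`j = 1`. -/
def pderiv (j : Fin 2) (φ : ℂ → ℂ) (z : ℂ) : ℂ := fderiv ℝ φ z (![1, Complex.I] j)

/-- `φ ∈ C_c^∞(Ω)`. -/
structure IsTestFunction (φ : ℂ → ℂ) : Prop where
  smooth : ContDiff ℝ ∞ φ
  compact : HasCompactSupport φ
  support : tsupport φ ⊆ disc

/-- `g` is the weak derivative `∂ⱼ u` in the disc. -/
def HasWeakDeriv (j : Fin 2) (u g : L2Disc) : Prop :=
  ∀ φ : ℂ → ℂ, IsTestFunction φ →
    ∫ z in disc, u z * pderiv j φ z = - ∫ z in disc, g z * φ z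

/-- The Sobolev space `H¹(Ω)`: an `L²` function together with its weak gradient in `L²`
(the gradient is determined by the function). -/
@[ext]
structure H1 where
  toL2 : L2Disc
  grad : Fin 2 → L2Disc
  weak : ∀ j, HasWeakDeriv j toL2 (grad j)

/-! ### The boundary spaces `L²(∂Ω)`, `H^{1/2}(∂Ω)`, `H^{-1/2}(∂Ω)` -/

instance fact_two_pi_pos : Fact (0 < 2 * Real.pi) := ⟨Real.two_pi_pos⟩

/-- The unit circle, parametrized by the angle. -/
abbrev Bdry : Type := AddCircle (2 * Real.pi)

/-- The boundary point `e^{iθ}`. -/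
def bdryPoint (θ : Bdry) : ℂ := (AddCircle.toCircle θ : ℂ)

/-- `L²(∂Ω)` with respect to arc length `dθ` (total length `2π`). -/
abbrev L2Bdry : Type := Lp ℂ 2 (volume : Measure Bdry)

/-- The weighted Fourier coefficient `(1 + k²)^{1/4} f̂(k)`, where
`f̂(k) = (2π)⁻¹ ∫ f(θ) e^{-ikθ} dθ`. -/
def wcoeff (f : Bdry → ℂ) (k : ℤ) : ℂ :=
  (((1 + (k : ℝ) ^ 2) ^ (1 / 4 : ℝ) : ℝ) : ℂ) * fourierCoeff f k

lemma weight_pos (k : ℤ) : 0 < (1 + (k : ℝ) ^ 2) ^ (1 / 4 : ℝ) := by positivity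

lemma one_le_weight (k : ℤ) : 1 ≤ (1 + (k : ℝ) ^ 2) ^ (1 / 4 : ℝ) :=
  Real.one_le_rpow (by nlinarith [sq_nonneg (k : ℝ)]) (by norm_num)

lemma integrable_bdry (f : L2Bdry) : Integrable f AddCircle.haarAddCircle :=
  ((Lp.memLp f).haarAddCircle).integrable (by norm_num)

lemma ae_haar_of_ae {P : Bdry → Prop} (h : ∀ᵐ x ∂(volume : Measure Bdry), P x) :
    ∀ᵐ x ∂(AddCircle.haarAddCircle : Measure Bdry), P x := by
  rw [AddCircle.volume_eq_smul_haarAddCircle] at h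
  exact (Measure.ae_ennreal_smul_measure_iff (by simp [Real.pi_pos])).1 h

lemma wcoeff_add (f g : L2Bdry) (k : ℤ) :
    wcoeff (f + g : L2Bdry) k = wcoeff f k + wcoeff g k := by
  have h : fourierCoeff ((f + g : L2Bdry) : Bdry → ℂ) = fourierCoeff f + fourierCoeff g := by
    rw [← fourierCoeff.add (integrable_bdry f) (integrable_bdry g)]
    exact fourierCoeff_congr_ae (ae_haar_of_ae (Lp.coeFn_add f g))
  simp only [wcoeff, h, Pi.add_apply, mul_add]

lemma wcoeff_smul (c : ℂ) (f : L2Bdry) (k : ℤ) :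
    wcoeff (c • f : L2Bdry) k = c * wcoeff f k := by
  have h : fourierCoeff ((c • f : L2Bdry) : Bdry → ℂ) = fourierCoeff (c • (f : Bdry → ℂ)) :=
    fourierCoeff_congr_ae (ae_haar_of_ae (Lp.coeFn_smul c f))
  simp only [wcoeff, h, fourierCoeff.const_smul, smul_eq_mul]
  ring

/-- The functions `f ∈ L²(∂Ω)` with `∑ₖ (1 + k²)^{1/2} |f̂(k)|² < ∞`. -/
def halfSubmodule : Submodule ℂ L2Bdry where
  carrier := {f | Memℓp (wcoeff f) 2}
  add_mem' {f g} hf hg := by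
    have h : wcoeff (f + g : L2Bdry) = wcoeff f + wcoeff g := funext (wcoeff_add f g)
    change Memℓp (wcoeff (f + g : L2Bdry)) 2
    rw [h]
    exact Memℓp.add hf hg
  zero_mem' := by
    have h : wcoeff (0 : L2Bdry) = 0 := by
      funext k
      simpa using wcoeff_smul 0 (0 : L2Bdry) k
    change Memℓp (wcoeff (0 : L2Bdry)) 2
    rw [h]
    exact zero_memℓp
  smul_mem' c f hf := by
    have h : wcoeff (c • f : L2Bdry) = c • wcoeff f := funext (wcoeff_smul c f)
    change Memℓp (wcoeff (c • f : L2Bdry)) 2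
    rw [h]
    exact Memℓp.const_smul (𝕜 := ℂ) hf c

/-- The Sobolev space `H^{1/2}(∂Ω)` of the unit circle, with
`‖f‖² = ∑ₖ (1 + k²)^{1/2} |f̂(k)|²`. -/
def HHalf : Type := halfSubmodule

namespace HHalf

instance : AddCommGroup HHalf := inferInstanceAs (AddCommGroup halfSubmodule)

instance : Module ℂ HHalf := inferInstanceAs (Module ℂ halfSubmodule)

/-- An element of `H^{1/2}(∂Ω)` as a function in `L²(∂Ω)`. -/
def toL2 : HHalf →ₗ[ℂ] L2Bdry := halfSubmodule.subtype

/-- The map `f ↦ ((1 + k²)^{1/4} f̂(k))ₖ` from `H^{1/2}(∂Ω)` to `ℓ²(ℤ)`. -/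
def toSeq : HHalf →ₗ[ℂ] lp (fun _ : ℤ => ℂ) 2 where
  toFun f := ⟨wcoeff (toL2 f), f.2⟩
  map_add' f g := by
    ext k
    exact wcoeff_add (toL2 f) (toL2 g) k
  map_smul' c f := by
    ext k
    exact wcoeff_smul c (toL2 f) k

lemma toSeq_apply (f : HHalf) (k : ℤ) : toSeq f k = wcoeff (toL2 f) k := rfl

/-- An `L²(∂Ω)` function as an `L²` function for the normalized measure. -/
def toHaar (f : L2Bdry) : Lp ℂ 2 (AddCircle.haarAddCircle : Measure Bdry) :=
  ((Lp.memLp f).haarAddCircle).toLp f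

lemma fourierCoeff_toHaar (f : L2Bdry) : fourierCoeff (toHaar f) = fourierCoeff f :=
  fourierCoeff_congr_ae (MemLp.coeFn_toLp _)

lemma norm_toHaar (f : L2Bdry) :
    ‖f‖ ^ 2 = 2 * Real.pi * ‖toHaar f‖ ^ 2 := by
  have h (g : Bdry → ℂ) : eLpNorm g 2 (volume : Measure Bdry) =
      ENNReal.ofReal (2 * Real.pi) ^ (1 / (2 : ℝ≥0∞)).toReal *
        eLpNorm g 2 AddCircle.haarAddCircle := by
    rw [AddCircle.volume_eq_smul_haarAddCircle,
      eLpNorm_smul_measure_of_ne_top (by norm_num), smul_eq_mul]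
  rw [toHaar, Lp.norm_toLp, Lp.norm_def, h, ENNReal.toReal_mul, mul_pow]
  congr 1
  rw [← ENNReal.toReal_rpow, ENNReal.toReal_ofReal Real.two_pi_pos.le, ← Real.rpow_natCast,
    ← Real.rpow_mul Real.two_pi_pos.le]
  norm_num

lemma injective_toSeq : Function.Injective toSeq := by
  rw [injective_iff_map_eq_zero]
  intro f hf
  have h0 : ∀ k, fourierCoeff (toL2 f) k = 0 := fun k => by
    have h1 : wcoeff (toL2 f) k = 0 := by rw [← toSeq_apply, hf]; rfl
    exact (mul_eq_zero.1 h1).resolve_left (by exact_mod_cast (weight_pos k).ne')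
  have h2 : toHaar (toL2 f) = 0 := by
    apply fourierBasis.repr.injective
    ext k
    rw [fourierBasis_repr, fourierCoeff_toHaar, h0]
    simp
  have h3 : toL2 f = 0 := by
    have := norm_toHaar (toL2 f)
    rw [h2] at this
    simpa using this
  exact Subtype.ext h3

instance : NormedAddCommGroup HHalf :=
  NormedAddCommGroup.induced HHalf (lp (fun _ : ℤ => ℂ) 2) toSeq injective_toSeq

instance : InnerProductSpace ℂ HHalf := InnerProductSpace.induced toSeq

lemma norm_toSeq (f : HHalf) : ‖toSeq f‖ = ‖f‖ := rfl

lemma surjective_toSeq : Function.Surjective toSeq := by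
  intro c
  have hd : Memℓp (fun k : ℤ => ((((1 + (k : ℝ) ^ 2) ^ (1 / 4 : ℝ) : ℝ) : ℂ))⁻¹ * c k) 2 := by
    refine (lp.memℓp c).mono' fun k => ?_
    rw [norm_mul, norm_inv, Complex.norm_real, Real.norm_of_nonneg (weight_pos k).le]
    exact mul_le_of_le_one_left (norm_nonneg _) (inv_le_one_of_one_le₀ (one_le_weight k))
  let g : Lp ℂ 2 (AddCircle.haarAddCircle : Measure Bdry) := fourierBasis.repr.symm ⟨_, hd⟩
  have hg : MemLp g 2 (volume : Measure Bdry) := (Lp.memLp g).of_haarAddCircle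
  have hco : ∀ k, wcoeff (hg.toLp g) k = c k := fun k => by
    have h1 : fourierCoeff (hg.toLp g) = fourierCoeff g :=
      fourierCoeff_congr_ae (ae_haar_of_ae (MemLp.coeFn_toLp _))
    have h2 : fourierCoeff g k = ((((1 + (k : ℝ) ^ 2) ^ (1 / 4 : ℝ) : ℝ) : ℂ))⁻¹ * c k := by
      rw [← fourierBasis_repr]
      simp [g]
    rw [wcoeff, h1, h2, mul_inv_cancel_left₀ (by exact_mod_cast (weight_pos k).ne')]
  refine ⟨⟨hg.toLp g, ?_⟩, ?_⟩
  · change Memℓp (wcoeff (hg.toLp g)) 2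
    rw [show wcoeff (hg.toLp g) = fun k => c k from funext hco]
    exact lp.memℓp c
  · ext k
    exact hco k

/-- `H^{1/2}(∂Ω)` is isometric to `ℓ²(ℤ)` through the weighted Fourier coefficients. -/
def equivSeq : HHalf ≃ₗᵢ[ℂ] lp (fun _ : ℤ => ℂ) 2 :=
  LinearIsometryEquiv.ofSurjective ⟨toSeq, norm_toSeq⟩ surjective_toSeq

instance : CompleteSpace HHalf :=
  (completeSpace_congr (e := equivSeq.toEquiv) equivSeq.isometry.isUniformEmbedding).2 inferInstance

lemma norm_toL2_le (f : HHalf) : ‖toL2 f‖ ≤ √(2 * Real.pi) * ‖f‖ := by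
  have h1 : ‖toHaar (toL2 f)‖ ≤ ‖f‖ := by
    rw [← norm_toSeq, ← fourierBasis.repr.norm_map]
    refine lp.norm_mono (by norm_num) fun k => ?_
    rw [fourierBasis_repr, fourierCoeff_toHaar, toSeq_apply, wcoeff, norm_mul, Complex.norm_real,
      Real.norm_of_nonneg (weight_pos k).le]
    exact le_mul_of_one_le_left (norm_nonneg _) (one_le_weight k)
  refine abs_le_of_sq_le_sq' ?_ (by positivity) |>.2
  rw [norm_toHaar, mul_pow, Real.sq_sqrt Real.two_pi_pos.le]
  gcongr

end HHalf

/-- The inclusion `ι : H^{1/2}(∂Ω) → L²(∂Ω)`. -/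
def incl : HHalf →L[ℂ] L2Bdry := HHalf.toL2.mkContinuous _ HHalf.norm_toL2_le

/-- `H^{-1/2}(∂Ω)`, the space of bounded antilinear functionals on `H^{1/2}(∂Ω)`, with the
operator norm.  The pairing `⟨⟨ψ, g⟩⟩` is `ψ g`. -/
abbrev HMinusHalf : Type := HHalf →L⋆[ℂ] ℂ

lemma riesz_norm (f : HHalf) : ‖innerSLFlip ℂ f‖ = ‖f‖ := by
  refine ContinuousLinearMap.opNorm_eq_of_bounds (norm_nonneg _) (fun g => ?_) fun N hN h => ?_
  · rw [innerSLFlip_apply_apply, mul_comm]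
    exact norm_inner_le_norm g f
  · have h1 := h f
    rw [innerSLFlip_apply_apply, ← inner_self_re_eq_norm, inner_self_eq_norm_mul_norm] at h1
    rcases (norm_nonneg f).eq_or_lt with h0 | h0
    · rwa [← h0]
    · exact le_of_mul_le_mul_right h1 h0

lemma riesz_surjective : Function.Surjective (innerSLFlip ℂ : HHalf →L[ℂ] HMinusHalf) := by
  intro ψ
  let l : StrongDual ℂ HHalf :=
    { toFun := fun g => conj (ψ g)
      map_add' := fun g h => by simp
      map_smul' := fun c g => by simp
      cont := Complex.continuous_conj.comp ψ.continuous }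
  refine ⟨(InnerProductSpace.toDual ℂ HHalf).symm l, ?_⟩
  ext g
  rw [innerSLFlip_apply_apply, ← inner_conj_symm, InnerProductSpace.toDual_symm_apply]
  simp [l]

/-- The Riesz isomorphism `R : H^{1/2}(∂Ω) → H^{-1/2}(∂Ω)`, `⟨⟨R f, g⟩⟩ = ⟨f, g⟩`. -/
def riesz : HHalf ≃ₗᵢ[ℂ] HMinusHalf :=
  LinearIsometryEquiv.ofSurjective ⟨(innerSLFlip ℂ : HHalf →L[ℂ] HMinusHalf).toLinearMap, riesz_norm⟩
    riesz_surjective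

/-- The inner product of `H^{-1/2}(∂Ω)`, transported by the Riesz isomorphism; it induces the
operator norm. -/
instance : InnerProductSpace ℂ HMinusHalf where
  inner φ ψ := inner ℂ (riesz.symm φ) (riesz.symm ψ)
  norm_sq_eq_re_inner φ := by
    rw [← norm_sq_eq_re_inner (𝕜 := ℂ), LinearIsometryEquiv.norm_map]
  conj_inner_symm φ ψ := inner_conj_symm _ _
  add_left φ ψ χ := by rw [map_add, inner_add_left]
  smul_left φ ψ c := by rw [map_smul, inner_smul_left]

/-- The inclusion `J = ι* ι : H^{1/2}(∂Ω) → H^{-1/2}(∂Ω)`,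
`⟨⟨J f, g⟩⟩ = ⟨ι f, ι g⟩_{L²(∂Ω)}`. -/
def inclJ : HHalf →L[ℂ] HMinusHalf :=
  LinearMap.mkContinuous
    { toFun := fun f => (innerSLFlip ℂ (incl f)).comp incl
      map_add' := fun f g => by ext h; simp
      map_smul' := fun c f => by ext h; simp }
    (‖incl‖ * ‖incl‖) (fun f => by
      refine ContinuousLinearMap.opNorm_le_bound _ (by positivity) fun g => ?_
      calc ‖inner ℂ (incl g) (incl f)‖ ≤ ‖incl g‖ * ‖incl f‖ := norm_inner_le_norm _ _
        _ ≤ (‖incl‖ * ‖g‖) * (‖incl‖ * ‖f‖) := by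
          gcongr <;> exact incl.le_opNorm _
        _ = ‖incl‖ * ‖incl‖ * ‖f‖ * ‖g‖ := by ring)

lemma inclJ_apply (f g : HHalf) : inclJ f g = inner ℂ (incl g) (incl f) := rfl

/-! ### Traces -/

/-- `f ∈ L²(∂Ω)` is the Dirichlet trace of `u ∈ H¹(Ω)`: the trace operator is the continuous
extension to `H¹(Ω)` of the restriction map `φ ↦ φ|_{∂Ω}` on functions that are smooth up to the
boundary. -/
def IsTraceL2 (u : H1) (f : L2Bdry) : Prop :=
  ∃ φ : ℕ → ℂ → ℂ, (∀ n, ContDiff ℝ ∞ (φ n)) ∧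
    Tendsto (fun n => eLpNorm (fun z => φ n z - u.toL2 z) 2 (volume.restrict disc)) atTop (𝓝 0) ∧
    (∀ j, Tendsto (fun n => eLpNorm (fun z => pderiv j (φ n) z - u.grad j z) 2
      (volume.restrict disc)) atTop (𝓝 0)) ∧
    Tendsto (fun n => eLpNorm (fun θ : Bdry => φ n (bdryPoint θ) - f θ) 2 volume) atTop (𝓝 0)

/-- `γ_D u = f` for `u ∈ H¹(Ω)`, `f ∈ H^{1/2}(∂Ω)`. -/
def HasTrace (u : H1) (f : HHalf) : Prop := IsTraceL2 u (incl f)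

/-! ### The differential expression `L = -Δ + γ` -/

/-- The sesquilinear form `Φ(u, v) = ∑ⱼ ⟨∂ⱼ u, ∂ⱼ v⟩ + γ ⟨u, v⟩` of `L = -Δ + γ`. -/
def form (γ : ℝ) (u v : H1) : ℂ :=
  (∑ j, inner ℂ (v.grad j) (u.grad j)) + (γ : ℂ) * inner ℂ v.toL2 u.toL2

/-- `L u = w` in the sense of distributions on the disc, where `L = -Δ + γ`. -/
def WeakEq (γ : ℝ) (u : H1) (w : L2Disc) : Prop :=
  ∀ φ : ℂ → ℂ, IsTestFunction φ →
    (∑ j, ∫ z in disc, u.grad j z * pderiv j φ z) + (γ : ℂ) * (∫ z in disc, u.toL2 z * φ z)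
      = ∫ z in disc, w z * φ z

/-- `γ_N u = ψ`: `L u ∈ L²(Ω)`, and `ψ ∈ H^{-1/2}(∂Ω)` satisfies Green's first identity
`Φ(u, v) = ⟨L u, v⟩ + ⟨⟨ψ, γ_D v⟩⟩` for all `v ∈ H¹(Ω)`. -/
def HasConormal (γ : ℝ) (u : H1) (ψ : HMinusHalf) : Prop :=
  ∃ w : L2Disc, WeakEq γ u w ∧
    ∀ (v : H1) (h : HHalf), HasTrace v h → form γ u v = inner ℂ v.toL2 w + ψ h

/-! ### Realizations and resolvent sets -/

/-- The graph of the Dirichlet realization of `L = -Δ + γ`, the operator of the form `Φ` on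
`H¹₀(Ω)`, the space of `u ∈ H¹(Ω)` with `γ_D u = 0`. -/
def dirichletGraph (γ : ℝ) : Set (L2Disc × L2Disc) :=
  {x | ∃ u : H1, u.toL2 = x.1 ∧ HasTrace u 0 ∧
    ∀ v : H1, HasTrace v 0 → form γ u v = inner ℂ v.toL2 x.2}

/-- The graph of the realization of `L = -Δ + γ` with boundary condition
`γ_N u + Θ γ_D u = 0`, the operator of the form `Φ(u, v) + ⟨⟨Θ γ_D u, γ_D v⟩⟩` on `H¹(Ω)`. -/
def robinGraph (γ : ℝ) (Θ : HHalf →L[ℂ] HMinusHalf) : Set (L2Disc × L2Disc) :=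
  {x | ∃ (u : H1) (f : HHalf), u.toL2 = x.1 ∧ HasTrace u f ∧
    ∀ (v : H1) (h : HHalf), HasTrace v h → form γ u v + Θ f h = inner ℂ v.toL2 x.2}

/-- `lam` is in the resolvent set of the operator with graph `A`: some bounded operator `R` is the
inverse of `A - lam`, that is, `u ∈ dom A` and `A u - lam u = f` if and only if `u = R f`. -/
def InResolventSet (A : Set (L2Disc × L2Disc)) (lam : ℂ) : Prop :=
  ∃ R : L2Disc →L[ℂ] L2Disc, ∀ u f : L2Disc, (u, f + lam • u) ∈ A ↔ u = R f

/-! ### The Robin-to-Dirichlet and Dirichlet-to-Robin maps -/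

/-- `N = N_Θ(lam)` for `L = -Δ + γ`: `N g = γ_D u`, where `u ∈ H¹(Ω)` solves `L u = lam u` in `Ω`
and `γ_N u + Θ γ_D u = g` on `∂Ω`.  (The equivalence contains that a solution exists for every `g`
and that its trace is determined by `g`.) -/
def IsRobinToDirichlet (γ : ℝ) (Θ : HHalf →L[ℂ] HMinusHalf) (lam : ℂ)
    (N : HMinusHalf →L[ℂ] HHalf) : Prop :=
  ∀ (g : HMinusHalf) (f : HHalf), N g = f ↔
    ∃ (u : H1) (ψ : HMinusHalf), WeakEq γ u (lam • u.toL2) ∧ HasTrace u f ∧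
      HasConormal γ u ψ ∧ ψ + Θ f = g

/-- `M = M_Θ(lam)` for `L = -Δ + γ`: `M f = γ_N u + Θ γ_D u`, where `u ∈ H¹(Ω)` solves
`L u = lam u` in `Ω` and `γ_D u = f` on `∂Ω`. -/
def IsDirichletToRobin (γ : ℝ) (Θ : HHalf →L[ℂ] HMinusHalf) (lam : ℂ)
    (M : HHalf →L[ℂ] HMinusHalf) : Prop :=
  ∀ (f : HHalf) (g : HMinusHalf), M f = g ↔
    ∃ (u : H1) (ψ : HMinusHalf), WeakEq γ u (lam • u.toL2) ∧ HasTrace u f ∧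
      HasConormal γ u ψ ∧ ψ + Θ f = g

/-! ### Schatten classes -/

/-- `A` is in the Schatten–von Neumann class `B_p`: `A` is compact and `∑ s ^ p < ∞`, the sum over
the positive singular values `s` of `A`, that is, the `s > 0` for which `s ^ 2` is an eigenvalue of
`A* A`, each counted with the multiplicity of this eigenvalue. -/
def IsSchatten {H : Type*} [NormedAddCommGroup H] [InnerProductSpace ℂ H] [CompleteSpace H]
    (p : ℝ) (A : H →L[ℂ] H) : Prop :=
  IsCompactOperator A ∧
    Summable fun s : Set.Ioi (0 : ℝ) =>
      (Module.finrank ℂ (Module.End.eigenspace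
        ((ContinuousLinearMap.adjoint A ∘L A : H →L[ℂ] H) : H →ₗ[ℂ] H)
        (((s : ℝ) ^ 2 : ℝ) : ℂ)) : ℝ) * (s : ℝ) ^ p

end DiscRobin

end

open DiscRobin

/-! ### A Bessel-type power series -/

namespace DiscRobin

/-! Both equations have the form Δu = 4cu, with c = -λ/4 for `L` and c = (γ - λ)/4 for the second
operator, and the disc is rotation invariant, so everything is diagonal in the Fourier modes
e^{ikθ}. The separated solution `mode c k` is a smooth function with boundary value F_k e^{ikθ} and
normal derivative D_k e^{ikθ}, where F_k = `modeVal c k` and D_k = `modeDeriv c k`. Weighted Fourier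
coefficients and the Riesz map identify both boundary spaces with ℓ²(ℤ). There `inclJ` is
multiplication by 2π/w_k² with w_k = `weight k`, so the Robin-to-Dirichlet map is multiplication by
F_k/(2πq_k) and the Dirichlet-to-Robin map is multiplication by 2πq'_k/F'_k. Here q_k = (D_k +
μF_k)/w_k² is `robinSymbol`, and primes mark the data of the second operator.

That these multipliers really are the two maps has two halves. Existence: for square summable b the
series of (b_k/w_k) `mode c k` converges in H¹, because the modes are orthogonal there with squared
norms O(w_k²), and its sum has trace F_k b_k and conormal derivative 2πD_k b_k/w_k² in these
coordinates (`exists_solution`). Uniqueness: Green's identity of a solution against a single mode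
forces a linear relation between its Cauchy data (`cauchy_data_relation`). The resolvent hypotheses
enter through F'_k ≠ 0 and q_k ≠ 0: otherwise a mode would be an eigenfunction.

Hence `E - I` is diagonal with entries d_k = [F_k(D'_k + μ'F'_k) - F'_k(D_k + μF_k)] / [F'_k(D_k +
μF_k)]. Since D_k = |k|F_k + o(1) and F_k → 1, and likewise for the primed data, the terms of size
|k| in the numerator cancel and |k|d_k → μ' - μ ≠ 0 (`tendsto_natAbs_mul_sub_one`). The nonzero
singular values are the nonzero |d_k| with multiplicity (`isSchatten_iff_of_diagonal`), and the sum
of |k|^{-p} over nonzero integers is finite exactly when p > 1. -/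

/-- The coefficients `k! / (m! (m + k)!)`. -/
noncomputable def besselCoeff (k m : ℕ) : ℝ :=
  (k.factorial : ℝ) / ((m.factorial : ℝ) * ((m + k).factorial : ℝ))

/-- The entire function `x ↦ ∑ k! / (m! (m + k)!) (c x)^m`. Up to normalization,
`r ^ k * besselG (-t / 4) k (r ^ 2)` is the Bessel function `J_k (√t r)`. -/
noncomputable def besselG (c : ℝ) (k : ℕ) (x : ℝ) : ℝ := ∑' m, besselCoeff k m * (c * x) ^ m

lemma besselCoeff_nonneg (k m : ℕ) : 0 ≤ besselCoeff k m := by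
  unfold besselCoeff; positivity

lemma besselCoeff_le (k m : ℕ) : besselCoeff k m ≤ 1 / (m.factorial : ℝ) := by
  unfold besselCoeff
  have h1 : (k.factorial : ℝ) ≤ ((m + k).factorial : ℝ) := by
    exact_mod_cast Nat.factorial_le (Nat.le_add_left k m)
  rw [div_le_div_iff₀ (by positivity) (by positivity)]
  nlinarith [(Nat.cast_pos (α := ℝ)).2 m.factorial_pos]

lemma besselCoeff_zero (k : ℕ) : besselCoeff k 0 = 1 := by
  simp [besselCoeff, Nat.factorial_ne_zero]

/-- The coefficient identity behind termwise differentiation, which shifts `k` to `k + 1`. -/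
lemma besselCoeff_succ (k m : ℕ) :
    (m + 1 : ℝ) * besselCoeff k (m + 1) = besselCoeff (k + 1) m / (k + 1) := by
  have h : m + 1 + k = m + (k + 1) := by ring
  unfold besselCoeff
  rw [h, Nat.factorial_succ m, Nat.factorial_succ k]
  have := Nat.factorial_ne_zero (m + (k + 1))
  have := Nat.factorial_ne_zero m
  push_cast
  field_simp

/-- The three-term Bessel recurrence at the level of coefficients. Together with the derivative
formula it encodes the radial differential equation. -/
lemma besselCoeff_recurrence (k m : ℕ) :
    besselCoeff k (m + 1) = besselCoeff (k + 1) (m + 1) +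
      besselCoeff (k + 2) m / ((k + 1) * (k + 2)) := by
  have h1 : m + 1 + k = m + k + 1 := by ring
  have h2 : m + 1 + (k + 1) = m + k + 1 + 1 := by ring
  have h3 : m + (k + 2) = m + k + 1 + 1 := by ring
  unfold besselCoeff
  rw [h1, h2, h3, Nat.factorial_succ m, Nat.factorial_succ (k + 1), Nat.factorial_succ k,
    Nat.factorial_succ (m + k + 1)]
  have := Nat.factorial_ne_zero (m + k + 1)
  have := Nat.factorial_ne_zero m
  push_cast
  field_simp
  ring

lemma norm_besselCoeff_mul_pow_le (k m : ℕ) (y : ℝ) :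
    ‖besselCoeff k m * y ^ m‖ ≤ |y| ^ m / (m.factorial : ℝ) := by
  rw [norm_mul, norm_pow, Real.norm_of_nonneg (besselCoeff_nonneg k m), Real.norm_eq_abs,
    div_eq_inv_mul, ← one_div]
  gcongr
  exact besselCoeff_le k m

lemma summable_besselCoeff (k : ℕ) (y : ℝ) : Summable fun m => besselCoeff k m * y ^ m :=
  Summable.of_norm_bounded (Real.summable_pow_div_factorial |y|)
    fun m => norm_besselCoeff_mul_pow_le k m y

lemma abs_besselG_le (c : ℝ) (k : ℕ) (x : ℝ) : |besselG c k x| ≤ Real.exp |c * x| := by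
  have h := tsum_of_norm_bounded (Real.summable_pow_div_factorial |c * x|).hasSum
    fun m => norm_besselCoeff_mul_pow_le k m (c * x)
  rw [Real.exp_eq_exp_ℝ, NormedSpace.exp_eq_tsum_div]
  exact h

lemma besselG_eq_one_add (c : ℝ) (k : ℕ) (x : ℝ) :
    besselG c k x = 1 + ∑' m, besselCoeff k (m + 1) * (c * x) ^ (m + 1) := by
  rw [besselG, (summable_besselCoeff k (c * x)).tsum_eq_zero_add, besselCoeff_zero]
  simp

lemma besselG_zero (c : ℝ) (k : ℕ) : besselG c k 0 = 1 := by
  rw [besselG_eq_one_add]; simp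

lemma summable_besselCoeff_succ (k : ℕ) (y : ℝ) :
    Summable fun m => besselCoeff k (m + 1) * y ^ (m + 1) :=
  (summable_nat_add_iff 1).2 (summable_besselCoeff k y)

lemma hasDerivAt_besselG (c : ℝ) (k : ℕ) (x : ℝ) :
    HasDerivAt (besselG c k) (c / (k + 1) * besselG c (k + 1) x) x := by
  -- Termwise differentiation needs a majorant uniform in the variable, hence the restriction to a
  -- ball around 0 containing `x`.
  have hx : x ∈ Metric.ball (0 : ℝ) (|x| + 1) := by
    rw [mem_ball_zero_iff]; exact lt_add_one _
  have hfun : besselG c k = fun x => 1 + ∑' m, besselCoeff k (m + 1) * (c * x) ^ (m + 1) :=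
    funext (besselG_eq_one_add c k)
  rw [hfun, besselG, ← tsum_mul_left]
  refine HasDerivAt.const_add (1 : ℝ) ?_
  refine hasDerivAt_tsum_of_isPreconnected
    (g := fun m x => besselCoeff k (m + 1) * (c * x) ^ (m + 1))
    (g' := fun m x => c / (k + 1) * (besselCoeff (k + 1) m * (c * x) ^ m))
    (t := Metric.ball 0 (|x| + 1)) (y₀ := 0)
    (u := fun m => |c / (k + 1)| * ((|c| * (|x| + 1)) ^ m / (m.factorial : ℝ)))
    ((Real.summable_pow_div_factorial _).mul_left _) Metric.isOpen_ball
    (convex_ball _ _).isPreconnected (fun m y _ => ?_) (fun m y hy => ?_)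
    (Metric.mem_ball_self (by positivity)) ?_ hx
  · have h := (((hasDerivAt_id y).const_mul c).pow (m + 1)).const_mul (besselCoeff k (m + 1))
    refine h.congr_deriv ?_
    have h2 := besselCoeff_succ k m
    simp only [id, Nat.add_sub_cancel]
    push_cast
    calc _ = ((m + 1 : ℝ) * besselCoeff k (m + 1)) * (c * y) ^ m * c := by ring
      _ = _ := by rw [h2]; ring
  · rw [norm_mul, Real.norm_eq_abs]
    gcongr
    refine (norm_besselCoeff_mul_pow_le _ _ _).trans ?_
    gcongr
    rw [abs_mul]
    gcongr
    simpa using (Metric.mem_ball.1 hy).le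
  · simp

lemma contDiff_besselG (c : ℝ) (k : ℕ) : ContDiff ℝ ∞ (besselG c k) := by
  rw [contDiff_infty]
  intro n
  induction n generalizing k with
  | zero =>
    exact contDiff_zero.2 (continuous_iff_continuousAt.2
      fun x => (hasDerivAt_besselG c k x).continuousAt)
  | succ n ih =>
    have : ((n + 1 : ℕ) : WithTop ℕ∞) = (n : WithTop ℕ∞) + 1 := by push_cast; rfl
    rw [this, contDiff_succ_iff_deriv]
    refine ⟨fun x => (hasDerivAt_besselG c k x).differentiableAt, by simp, ?_⟩
    rw [show deriv (besselG c k) = fun x => c / (k + 1) * besselG c (k + 1) x from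
      funext fun x => (hasDerivAt_besselG c k x).deriv]
    exact contDiff_const.mul (ih (k + 1))

lemma besselG_recurrence (c : ℝ) (k : ℕ) (x : ℝ) :
    besselG c k x = besselG c (k + 1) x +
      c * x / ((k + 1) * (k + 2)) * besselG c (k + 2) x := by
  rw [besselG_eq_one_add c k, besselG_eq_one_add c (k + 1), besselG, ← tsum_mul_left, add_assoc,
    ← (summable_besselCoeff_succ (k + 1) (c * x)).tsum_add
      ((summable_besselCoeff (k + 2) (c * x)).mul_left _)]
  congr 2
  funext m
  rw [besselCoeff_recurrence]
  ring

/-- Mean value inequality on [0, 1]: the function is 1 at 0 and its derivative carries the factor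
1/(k + 1). -/
lemma abs_besselG_sub_one_le (c : ℝ) (k : ℕ) :
    |besselG c k 1 - 1| ≤ |c| * Real.exp |c| / (k + 1) := by
  have h := (convex_Icc (0 : ℝ) 1).norm_image_sub_le_of_norm_hasDerivWithin_le
    (f := besselG c k) (f' := fun x => c / (k + 1) * besselG c (k + 1) x)
    (C := |c| * Real.exp |c| / (k + 1)) (fun x _ => (hasDerivAt_besselG c k x).hasDerivWithinAt)
    (fun x hx => ?_) (Set.left_mem_Icc.2 zero_le_one) (Set.right_mem_Icc.2 zero_le_one)
  · simpa [besselG_zero] using h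
  · have h1 : |besselG c (k + 1) x| ≤ Real.exp |c| := by
      refine (abs_besselG_le c (k + 1) x).trans ?_
      rw [Real.exp_le_exp, abs_mul]
      refine mul_le_of_le_one_right (abs_nonneg c) ?_
      rw [abs_of_nonneg hx.1]
      exact hx.2
    rw [norm_mul, norm_div, Real.norm_eq_abs, Real.norm_eq_abs, Real.norm_eq_abs,
      abs_of_pos (by positivity : (0 : ℝ) < k + 1), div_mul_eq_mul_div]
    gcongr

end DiscRobin

/-! ### Separated solutions of the Helmholtz equation -/

namespace DiscRobin

section pderiv

variable {j : Fin 2} {φ ψ : ℂ → ℂ} {z : ℂ}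

lemma pderiv_mul (hφ : DifferentiableAt ℝ φ z) (hψ : DifferentiableAt ℝ ψ z) :
    pderiv j (fun z => φ z * ψ z) z = pderiv j φ z * ψ z + φ z * pderiv j ψ z := by
  simp only [pderiv]
  rw [fderiv_fun_mul hφ hψ]
  simp only [add_apply, smul_apply, smul_eq_mul]
  ring

lemma pderiv_add (hφ : DifferentiableAt ℝ φ z) (hψ : DifferentiableAt ℝ ψ z) :
    pderiv j (fun z => φ z + ψ z) z = pderiv j φ z + pderiv j ψ z := by
  simp only [pderiv]
  rw [fderiv_fun_add hφ hψ]
  rfl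

lemma pderiv_const_mul (c : ℂ) (hφ : DifferentiableAt ℝ φ z) :
    pderiv j (fun z => c * φ z) z = c * pderiv j φ z := by
  simp only [pderiv]
  rw [fderiv_const_mul hφ]
  rfl

lemma pderiv_conj : pderiv j (fun z => conj (φ z)) z = conj (pderiv j φ z) := by
  simp only [pderiv]
  have h := (Complex.conjCLE : ℂ ≃L[ℝ] ℂ).comp_fderiv (f := φ) (x := z)
  have h2 : (Complex.conjCLE ∘ φ : ℂ → ℂ) = fun z => conj (φ z) := rfl
  rw [h2] at h
  rw [h]
  rfl

lemma contDiff_pderiv (hφ : ContDiff ℝ ∞ φ) : ContDiff ℝ ∞ (pderiv j φ) :=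
  (hφ.fderiv_right (m := ∞) (by simp)).clm_apply contDiff_const

end pderiv

/-- The coordinate functions of the plane. -/
noncomputable def coord (j : Fin 2) (z : ℂ) : ℂ := ((![z.re, z.im] j : ℝ) : ℂ)

lemma contDiff_coord (j : Fin 2) : ContDiff ℝ ∞ (coord j) := by
  unfold coord
  fin_cases j
  · exact (Complex.ofRealCLM.comp Complex.reCLM).contDiff
  · exact (Complex.ofRealCLM.comp Complex.imCLM).contDiff

lemma pderiv_coord (j : Fin 2) (z : ℂ) : pderiv j (coord j) z = 1 := by
  unfold pderiv
  fin_cases j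
  · have : coord 0 = Complex.ofRealCLM.comp Complex.reCLM := rfl
    simp [this, ContinuousLinearMap.fderiv]
  · have : coord 1 = Complex.ofRealCLM.comp Complex.imCLM := rfl
    simp [this, ContinuousLinearMap.fderiv]

lemma hasFDerivAt_normSq (z : ℂ) : HasFDerivAt (fun z : ℂ => Complex.normSq z)
    ((2 * z.re) • Complex.reCLM + (2 * z.im) • Complex.imCLM) z := by
  have h1 : HasFDerivAt (fun z : ℂ => z.re) Complex.reCLM z := Complex.reCLM.hasFDerivAt
  have h2 : HasFDerivAt (fun z : ℂ => z.im) Complex.imCLM z := Complex.imCLM.hasFDerivAt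
  have h := (h1.mul h1).add (h2.mul h2)
  have h3 : (fun z : ℂ => Complex.normSq z) =
      (fun z : ℂ => z.re) * (fun z : ℂ => z.re) + (fun z : ℂ => z.im) * (fun z : ℂ => z.im) := by
    funext z; simp [Complex.normSq_apply]
  rw [h3]
  refine h.congr_fderiv ?_
  ext v
  simp
  ring

lemma contDiff_normSq : ContDiff ℝ ∞ (fun z : ℂ => Complex.normSq z) := by
  have : (fun z : ℂ => Complex.normSq z) = fun z => z.re * z.re + z.im * z.im :=
    funext Complex.normSq_apply
  rw [this]
  exact (Complex.reCLM.contDiff.mul Complex.reCLM.contDiff).add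
    (Complex.imCLM.contDiff.mul Complex.imCLM.contDiff)

lemma contDiff_radial {g : ℝ → ℝ} (hg : ContDiff ℝ ∞ g) :
    ContDiff ℝ ∞ (fun z : ℂ => (g (Complex.normSq z) : ℂ)) :=
  Complex.ofRealCLM.contDiff.comp (hg.comp contDiff_normSq)

lemma pderiv_radial {g : ℝ → ℝ} {g' : ℝ} {z : ℂ} (hg : HasDerivAt g g' (Complex.normSq z))
    (j : Fin 2) :
    pderiv j (fun z => (g (Complex.normSq z) : ℂ)) z = 2 * g' * coord j z := by
  have h1 := Complex.ofRealCLM.hasFDerivAt.comp z (hg.comp_hasFDerivAt z (hasFDerivAt_normSq z))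
  unfold pderiv
  have h2 : (Complex.ofRealCLM ∘ (g ∘ fun z : ℂ => Complex.normSq z) : ℂ → ℂ) =
    (fun z => (g (Complex.normSq z) : ℂ)) := rfl
  rw [h2] at h1
  rw [h1.fderiv]
  fin_cases j <;> simp [coord] <;> ring

/-- The coordinate `z` for `k ≥ 0` and its conjugate for `k < 0`. -/
noncomputable def angularCoord (k : ℤ) : ℂ →L[ℝ] ℂ :=
  if 0 ≤ k then ContinuousLinearMap.id ℝ ℂ else (Complex.conjCLE : ℂ →L[ℝ] ℂ)

/-- The gradient (1, ±i) is isotropic, which makes the powers of `angularCoord k` harmonic. -/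
lemma angularCoord_sq (k : ℤ) : angularCoord k 1 ^ 2 + angularCoord k Complex.I ^ 2 = 0 := by
  unfold angularCoord; split_ifs <;> simp

lemma angularCoord_eq (k : ℤ) (z : ℂ) :
    angularCoord k 1 * coord 0 z + angularCoord k Complex.I * coord 1 z = angularCoord k z := by
  unfold angularCoord coord; split_ifs <;> apply Complex.ext <;> simp

lemma coord_sq (z : ℂ) : coord 0 z ^ 2 + coord 1 z ^ 2 = (Complex.normSq z : ℂ) := by
  simp [coord, Complex.normSq_apply]; ring

lemma norm_angularCoord (k : ℤ) (z : ℂ) : ‖angularCoord k z‖ = ‖z‖ := by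
  unfold angularCoord; split_ifs <;> simp

lemma pderiv_angularCoord_pow (k : ℤ) (n : ℕ) (j : Fin 2) (z : ℂ) :
    pderiv j (fun z => angularCoord k z ^ n) z =
      n * angularCoord k z ^ (n - 1) * angularCoord k (![1, Complex.I] j) := by
  unfold pderiv
  have h := ((angularCoord k).hasFDerivAt (x := z)).pow n
  rw [h.fderiv]
  simp

/-- The separated solution `r^|k| G(r²) e^{ikθ}` of `Δ φ = 4 c φ`. -/
noncomputable def mode (c : ℝ) (k : ℤ) (z : ℂ) : ℂ :=
  angularCoord k z ^ k.natAbs * (besselG c k.natAbs (Complex.normSq z) : ℂ)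

/-- The boundary value of the radial part of `mode c k`. -/
noncomputable def modeVal (c : ℝ) (k : ℤ) : ℝ := besselG c k.natAbs 1

/-- The normal derivative at the boundary of the radial part of `mode c k`. -/
noncomputable def modeDeriv (c : ℝ) (k : ℤ) : ℝ :=
  k.natAbs * besselG c k.natAbs 1 + 2 * (c / (k.natAbs + 1) * besselG c (k.natAbs + 1) 1)

lemma contDiff_angularCoord_pow (k : ℤ) (n : ℕ) :
    ContDiff ℝ ∞ (fun z => angularCoord k z ^ n) :=
  (angularCoord k).contDiff.pow n

lemma contDiff_mode (c : ℝ) (k : ℤ) : ContDiff ℝ ∞ (mode c k) :=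
  (contDiff_angularCoord_pow _ _).mul (contDiff_radial (contDiff_besselG _ _))

lemma differentiableAt_of_smooth {φ : ℂ → ℂ} (h : ContDiff ℝ ∞ φ) (z : ℂ) :
    DifferentiableAt ℝ φ z := h.differentiable (by simp) z

lemma pderiv_mode (c : ℝ) (k : ℤ) (j : Fin 2) (z : ℂ) :
    pderiv j (mode c k) z =
      k.natAbs * angularCoord k (![1, Complex.I] j) *
        (angularCoord k z ^ (k.natAbs - 1) * (besselG c k.natAbs (Complex.normSq z) : ℂ)) +
      2 * (c / (k.natAbs + 1)) * ((angularCoord k z ^ k.natAbs *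
        (besselG c (k.natAbs + 1) (Complex.normSq z) : ℂ)) * coord j z) := by
  have h1 := differentiableAt_of_smooth (contDiff_angularCoord_pow k k.natAbs) z
  have h2 := differentiableAt_of_smooth (contDiff_radial (contDiff_besselG c k.natAbs)) z
  have h := pderiv_mul (j := j) h1 h2
  rw [pderiv_angularCoord_pow, pderiv_radial (hasDerivAt_besselG _ _ _)] at h
  refine Eq.trans h ?_
  push_cast
  ring

lemma laplacian_mode (c : ℝ) (k : ℤ) (z : ℂ) :
    pderiv 0 (pderiv 0 (mode c k)) z + pderiv 1 (pderiv 1 (mode c k)) z =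
      4 * c * mode c k z := by
  set n := k.natAbs with hn
  -- With Z = `angularCoord k z` and G = `besselG c n`, these are the terms of Δ(Zⁿ G(|z|²)). Summed
  -- over `j`, the first vanishes because Zⁿ is harmonic, the cross term gives 4nG'Zⁿ, and the last
  -- two give (4G' + 4|z|²G'')Zⁿ. The recurrence then collapses the total to 4cGZⁿ.
  have key : ∀ j, pderiv j (pderiv j (mode c k)) z =
      n * ((n - 1 : ℕ) : ℂ) * angularCoord k z ^ (n - 1 - 1) * angularCoord k (![1, Complex.I] j) ^ 2
          * (besselG c n (Complex.normSq z) : ℂ) +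
      4 * (c / (n + 1)) * n * angularCoord k z ^ (n - 1)
          * (angularCoord k (![1, Complex.I] j) * coord j z)
          * (besselG c (n + 1) (Complex.normSq z) : ℂ) +
      2 * (c / (n + 1)) * angularCoord k z ^ n * (besselG c (n + 1) (Complex.normSq z) : ℂ) +
      4 * (c / (n + 1)) * (c / (n + 2)) * angularCoord k z ^ n * coord j z ^ 2 *
          (besselG c (n + 2) (Complex.normSq z) : ℂ) := by
    intro j
    rw [show pderiv j (mode c k) = _ from funext (pderiv_mode c k j), ← hn]
    have d1 := contDiff_angularCoord_pow k (n - 1)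
    have d2 := contDiff_angularCoord_pow k n
    have d3 := contDiff_radial (contDiff_besselG c n)
    have d4 := contDiff_radial (contDiff_besselG c (n + 1))
    have d5 := contDiff_coord j
    have a1 := differentiableAt_of_smooth (d1.mul d3) z
    have a2 := differentiableAt_of_smooth (d2.mul d4) z
    have a3 := differentiableAt_of_smooth ((d2.mul d4).mul d5) z
    rw [pderiv_add (a1.const_mul _) (a3.const_mul _), pderiv_const_mul _ a1,
      pderiv_const_mul _ a3, pderiv_mul a2 (differentiableAt_of_smooth d5 z),
      pderiv_mul (differentiableAt_of_smooth d1 z) (differentiableAt_of_smooth d3 z),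
      pderiv_mul (differentiableAt_of_smooth d2 z) (differentiableAt_of_smooth d4 z),
      pderiv_angularCoord_pow, pderiv_angularCoord_pow, pderiv_coord,
      pderiv_radial (hasDerivAt_besselG _ _ _), pderiv_radial (hasDerivAt_besselG _ _ _)]
    push_cast
    have : (n : ℂ) + 1 + 1 = n + 2 := by ring
    rw [this]
    ring
  have e1 := angularCoord_sq k
  have e2 := angularCoord_eq k z
  have e3 := coord_sq z
  -- For n = 0 the truncated exponent is harmless, since both sides vanish.
  have e4 : (n : ℂ) * angularCoord k z ^ (n - 1) * angularCoord k z = n * angularCoord k z ^ n := by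
    rcases Nat.eq_zero_or_pos n with h | h
    · simp [h]
    · rw [mul_assoc, ← pow_succ, Nat.sub_add_cancel h]
  have e5 : (besselG c n (Complex.normSq z) : ℂ) = besselG c (n + 1) (Complex.normSq z) +
      c * Complex.normSq z / ((n + 1) * (n + 2)) * besselG c (n + 2) (Complex.normSq z) := by
    exact_mod_cast besselG_recurrence c n (Complex.normSq z)
  have hn1 : (n : ℂ) + 1 ≠ 0 := by exact_mod_cast Nat.succ_ne_zero n
  have hn2 : (n : ℂ) + 2 ≠ 0 := by exact_mod_cast Nat.succ_ne_zero (n + 1)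
  have e6 : 4 * c * mode c k z = 4 * c * (angularCoord k z ^ n *
    (besselG c (n + 1) (Complex.normSq z) +
      c * Complex.normSq z / ((n + 1) * (n + 2)) * besselG c (n + 2) (Complex.normSq z))) := by
    rw [← e5]; rfl
  rw [key 0, key 1, e6, ← e3]
  simp only [Matrix.cons_val_zero, Matrix.cons_val_one]
  have e7 : 4 * (c : ℂ) / (n + 1) * (n * angularCoord k z ^ n) *
        (besselG c (n + 1) (Complex.normSq z) : ℂ) +
      4 * (c / (n + 1)) * angularCoord k z ^ n * (besselG c (n + 1) (Complex.normSq z) : ℂ) =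
      4 * c * angularCoord k z ^ n * (besselG c (n + 1) (Complex.normSq z) : ℂ) := by
    field_simp
  have e8 : (c : ℂ) * (coord 0 z ^ 2 + coord 1 z ^ 2) / ((n + 1) * (n + 2)) =
      (c / (n + 1)) * (1 / (n + 2)) * (coord 0 z ^ 2 + coord 1 z ^ 2) := by
    field_simp
  rw [e8]
  linear_combination (n * ((n - 1 : ℕ) : ℂ) * angularCoord k z ^ (n - 1 - 1) *
    (besselG c n (Complex.normSq z) : ℂ)) * e1 +
    (4 * (c / (n + 1)) * n * angularCoord k z ^ (n - 1) *
      (besselG c (n + 1) (Complex.normSq z) : ℂ)) * e2 +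
    4 * (c / (n + 1)) * (besselG c (n + 1) (Complex.normSq z) : ℂ) * e4 + e7

lemma normSq_bdryPoint (θ : Bdry) : Complex.normSq (bdryPoint θ) = 1 := by
  simp [bdryPoint]

lemma angularCoord_bdryPoint_pow (k : ℤ) (θ : Bdry) :
    angularCoord k (bdryPoint θ) ^ k.natAbs = fourier k θ := by
  have h : (fourier k θ : ℂ) = (AddCircle.toCircle θ : ℂ) ^ k := by
    rw [fourier_apply, AddCircle.toCircle_zsmul, Circle.coe_zpow]
  rw [h]
  unfold angularCoord bdryPoint
  split_ifs with hk
  · obtain ⟨n, rfl⟩ := Int.eq_ofNat_of_zero_le hk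
    simp
  · obtain ⟨n, hn⟩ := Int.eq_ofNat_of_zero_le (by omega : 0 ≤ -k)
    obtain rfl : k = -n := by omega
    simp [← Circle.coe_inv_eq_conj]

lemma mode_bdryPoint (c : ℝ) (k : ℤ) (θ : Bdry) :
    mode c k (bdryPoint θ) = modeVal c k * fourier k θ := by
  rw [mode, angularCoord_bdryPoint_pow, normSq_bdryPoint, modeVal, mul_comm]

/-- On the unit circle the position vector is the outward normal. Homogeneity of the angular factor
contributes |k|G(1), and the chain rule for G(r²) contributes 2G'(1). -/
lemma normalDeriv_mode (c : ℝ) (k : ℤ) (θ : Bdry) :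
    coord 0 (bdryPoint θ) * pderiv 0 (mode c k) (bdryPoint θ) +
      coord 1 (bdryPoint θ) * pderiv 1 (mode c k) (bdryPoint θ) =
      modeDeriv c k * fourier k θ := by
  have e2 := angularCoord_eq k (bdryPoint θ)
  have e3 := coord_sq (bdryPoint θ)
  have e4 : (k.natAbs : ℂ) * angularCoord k (bdryPoint θ) ^ (k.natAbs - 1) *
      angularCoord k (bdryPoint θ) = k.natAbs * fourier k θ := by
    rw [← angularCoord_bdryPoint_pow]
    rcases Nat.eq_zero_or_pos k.natAbs with h | h
    · simp [h]
    · rw [mul_assoc, ← pow_succ, Nat.sub_add_cancel h]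
  rw [normSq_bdryPoint] at e3
  rw [pderiv_mode, pderiv_mode, normSq_bdryPoint, angularCoord_bdryPoint_pow, modeDeriv]
  simp only [Matrix.cons_val_zero, Matrix.cons_val_one]
  push_cast at e3 ⊢
  linear_combination (k.natAbs * angularCoord k (bdryPoint θ) ^ (k.natAbs - 1) *
    (besselG c k.natAbs 1 : ℂ)) * e2 + (besselG c k.natAbs 1 : ℂ) * e4 +
    2 * (c / (k.natAbs + 1)) * (fourier k θ * (besselG c (k.natAbs + 1) 1 : ℂ)) * e3

end DiscRobin

/-! ### The divergence theorem on the disc -/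

namespace DiscRobin

lemma fderiv_eq_pderiv (X : ℂ → ℂ) (z v : ℂ) :
    fderiv ℝ X z v = v.re * pderiv 0 X z + v.im * pderiv 1 X z := by
  have h : v = v.re • (1 : ℂ) + v.im • Complex.I := by
    simp [Complex.re_add_im]
  conv_lhs => rw [h, map_add, map_smul, map_smul]
  simp [pderiv]

/-- Polar coordinates, `(r, θ) ↦ r e^{iθ}`. -/
noncomputable def polarPoint (p : ℝ × ℝ) : ℂ := (p.1 : ℂ) * (Real.cos p.2 + Real.sin p.2 * Complex.I)

lemma contDiff_ofReal_comp {E : Type*} [NormedAddCommGroup E] [NormedSpace ℝ E] {f : E → ℝ}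
    (hf : ContDiff ℝ ∞ f) : ContDiff ℝ ∞ (fun p => (f p : ℂ)) :=
  Complex.ofRealCLM.contDiff.comp hf

lemma contDiff_polarPoint : ContDiff ℝ ∞ polarPoint := by
  have h1 : ContDiff ℝ ∞ (fun p : ℝ × ℝ => Real.cos p.2) := Real.contDiff_cos.comp contDiff_snd
  have h2 : ContDiff ℝ ∞ (fun p : ℝ × ℝ => Real.sin p.2) := Real.contDiff_sin.comp contDiff_snd
  exact (contDiff_ofReal_comp contDiff_fst).mul
    ((contDiff_ofReal_comp h1).add ((contDiff_ofReal_comp h2).mul contDiff_const))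

lemma hasDerivAt_polarPoint_fst (r θ : ℝ) : HasDerivAt (fun r => polarPoint (r, θ))
    (Real.cos θ + Real.sin θ * Complex.I) r := by
  simpa [polarPoint] using ((hasDerivAt_id r).ofReal_comp.mul_const
    ((Real.cos θ : ℂ) + Real.sin θ * Complex.I))

lemma hasDerivAt_polarPoint_snd (r θ : ℝ) : HasDerivAt (fun θ => polarPoint (r, θ))
    (r * (-Real.sin θ + Real.cos θ * Complex.I)) θ := by
  have h1 := (Real.hasDerivAt_cos θ).ofReal_comp
  have h2 := (Real.hasDerivAt_sin θ).ofReal_comp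
  have := (h1.add (h2.mul_const Complex.I)).const_mul (r : ℂ)
  simpa [polarPoint] using this

/-- Integration over the disc in polar coordinates. -/
lemma setIntegral_disc_eq (f : ℂ → ℂ) :
    ∫ z in disc, f z = ∫ p in Set.Ioo (0 : ℝ) 1 ×ˢ Set.Ioo (-Real.pi) Real.pi,
      (p.1 : ℂ) * f (polarPoint p) := by
  have hd : MeasurableSet disc := measurableSet_ball
  rw [← integral_indicator hd, ← Complex.integral_comp_polarCoord_symm]
  have h1 : ∀ p : ℝ × ℝ, p ∈ polarCoord.target →
      p.1 • disc.indicator f (Complex.polarCoord.symm p) =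
      (Set.Iio (1 : ℝ) ×ˢ (Set.univ : Set ℝ)).indicator
        (fun p => (p.1 : ℂ) * f (polarPoint p)) p := by
    intro p hp
    have hp1 : 0 < p.1 := hp.1
    have h2 : Complex.polarCoord.symm p = polarPoint p := Complex.polarCoord_symm_apply p
    have h3 : polarPoint p ∈ disc ↔ p ∈ Set.Iio (1 : ℝ) ×ˢ (Set.univ : Set ℝ) := by
      rw [← h2, disc, mem_ball_zero_iff, Complex.norm_polarCoord_symm, abs_of_pos hp1]
      simp
    rw [h2]
    by_cases h : polarPoint p ∈ disc
    · rw [Set.indicator_of_mem h, Set.indicator_of_mem (h3.1 h), Complex.real_smul]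
    · rw [Set.indicator_of_notMem h, Set.indicator_of_notMem (h3.not.1 h), smul_zero]
  rw [setIntegral_congr_fun polarCoord.open_target.measurableSet h1,
    setIntegral_indicator (measurableSet_Iio.prod MeasurableSet.univ)]
  congr 2
  ext p
  simp [polarCoord_target]
  tauto

lemma fderiv_apply_fst {f : ℝ × ℝ → ℂ} {r θ : ℝ} {d : ℂ} (hf : DifferentiableAt ℝ f (r, θ))
    (h : HasDerivAt (fun r => f (r, θ)) d r) : fderiv ℝ f (r, θ) (1, 0) = d := by
  have h1 : HasDerivAt (fun r : ℝ => (r, θ)) ((1 : ℝ), (0 : ℝ)) r :=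
    (hasDerivAt_id r).prodMk (hasDerivAt_const r θ)
  exact (hf.hasFDerivAt.comp_hasDerivAt r h1).unique h

lemma fderiv_apply_snd {f : ℝ × ℝ → ℂ} {r θ : ℝ} {d : ℂ} (hf : DifferentiableAt ℝ f (r, θ))
    (h : HasDerivAt (fun θ => f (r, θ)) d θ) : fderiv ℝ f (r, θ) (0, 1) = d := by
  have h1 : HasDerivAt (fun θ : ℝ => (r, θ)) ((0 : ℝ), (1 : ℝ)) θ :=
    (hasDerivAt_const θ r).prodMk (hasDerivAt_id θ)
  exact (hf.hasFDerivAt.comp_hasDerivAt θ h1).unique h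

lemma polarPoint_one (θ : ℝ) : polarPoint (1, θ) = bdryPoint (θ : Bdry) := by
  rw [bdryPoint, AddCircle.toCircle_apply_mk, Circle.coe_exp, polarPoint]
  have : 2 * Real.pi / (2 * Real.pi) * θ = θ := by
    rw [div_self Real.two_pi_pos.ne', one_mul]
  rw [this, Complex.exp_mul_I]
  simp

/-- In polar coordinates r·div(X, Y) = ∂_r f + ∂_θ g, with f equal to r times the radial component
and g the angular component. This reduces the claim to the divergence theorem on the rectangle [0,
1] × [-π, π]. -/
lemma integral_divergence_disc {X Y : ℂ → ℂ} (hX : ContDiff ℝ ∞ X) (hY : ContDiff ℝ ∞ Y) :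
    ∫ z in disc, (pderiv 0 X z + pderiv 1 Y z) =
      ∫ θ : Bdry, (coord 0 (bdryPoint θ) * X (bdryPoint θ) +
        coord 1 (bdryPoint θ) * Y (bdryPoint θ)) := by
  set f : ℝ × ℝ → ℂ := fun p => (p.1 : ℂ) *
    (Real.cos p.2 * X (polarPoint p) + Real.sin p.2 * Y (polarPoint p)) with hf
  set g : ℝ × ℝ → ℂ := fun p =>
    Real.cos p.2 * Y (polarPoint p) - Real.sin p.2 * X (polarPoint p) with hg
  have hc : ContDiff ℝ ∞ (fun p : ℝ × ℝ => (Real.cos p.2 : ℂ)) :=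
    contDiff_ofReal_comp (Real.contDiff_cos.comp contDiff_snd)
  have hs : ContDiff ℝ ∞ (fun p : ℝ × ℝ => (Real.sin p.2 : ℂ)) :=
    contDiff_ofReal_comp (Real.contDiff_sin.comp contDiff_snd)
  have hXp := hX.comp contDiff_polarPoint
  have hYp := hY.comp contDiff_polarPoint
  have hfs : ContDiff ℝ ∞ f :=
    (contDiff_ofReal_comp contDiff_fst).mul ((hc.mul hXp).add (hs.mul hYp))
  have hgs : ContDiff ℝ ∞ g := (hc.mul hYp).sub (hs.mul hXp)
  have hfd : Differentiable ℝ f := hfs.differentiable (by simp)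
  have hgd : Differentiable ℝ g := hgs.differentiable (by simp)
  have hX1 : Differentiable ℝ X := hX.differentiable (by simp)
  have hY1 : Differentiable ℝ Y := hY.differentiable (by simp)
  have hdiv : ∀ p : ℝ × ℝ, fderiv ℝ f p (1, 0) + fderiv ℝ g p (0, 1) =
      (p.1 : ℂ) * (pderiv 0 X (polarPoint p) + pderiv 1 Y (polarPoint p)) := by
    rintro ⟨r, θ⟩
    have a1 := (hX1 (polarPoint (r, θ))).hasFDerivAt.comp_hasDerivAt r
      (hasDerivAt_polarPoint_fst r θ)
    have a2 := (hY1 (polarPoint (r, θ))).hasFDerivAt.comp_hasDerivAt r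
      (hasDerivAt_polarPoint_fst r θ)
    have b1 := (hX1 (polarPoint (r, θ))).hasFDerivAt.comp_hasDerivAt θ
      (hasDerivAt_polarPoint_snd r θ)
    have b2 := (hY1 (polarPoint (r, θ))).hasFDerivAt.comp_hasDerivAt θ
      (hasDerivAt_polarPoint_snd r θ)
    have c1 := (hasDerivAt_id r).ofReal_comp.mul
      ((a1.const_mul (Real.cos θ : ℂ)).add (a2.const_mul (Real.sin θ : ℂ)))
    have c2 := ((Real.hasDerivAt_cos θ).ofReal_comp.mul b2).sub
      ((Real.hasDerivAt_sin θ).ofReal_comp.mul b1)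
    rw [fderiv_apply_fst (hfd (r, θ)) c1, fderiv_apply_snd (hgd (r, θ)) c2]
    simp only [fderiv_eq_pderiv, Function.comp, id]
    simp [-Complex.ofReal_cos, -Complex.ofReal_sin]
    have e : (Real.sin θ : ℂ) ^ 2 + (Real.cos θ : ℂ) ^ 2 = 1 := by
      exact_mod_cast Real.sin_sq_add_cos_sq θ
    linear_combination (r : ℂ) *
      (pderiv 0 X (polarPoint (r, θ)) + pderiv 1 Y (polarPoint (r, θ))) * e
  have hle : ((0 : ℝ), -Real.pi) ≤ ((1 : ℝ), Real.pi) :=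
    ⟨zero_le_one, by linarith [Real.pi_pos]⟩
  have hint := integral_divergence_prod_Icc_of_hasFDerivAt_of_le f g (fderiv ℝ f) (fderiv ℝ g)
    (0, -Real.pi) (1, Real.pi) hle hfs.continuous.continuousOn hgs.continuous.continuousOn
    (fun x _ => (hfd x).hasFDerivAt) (fun x _ => (hgd x).hasFDerivAt)
    (((((hfs.continuous_fderiv (by simp)).clm_apply continuous_const).add
      ((hgs.continuous_fderiv (by simp)).clm_apply continuous_const)).continuousOn).integrableOn_compact
        isCompact_Icc)
  simp only [hdiv] at hint
  -- The two angular edges cancel by periodicity and the edge r = 0 vanishes by the factor r, so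
  -- only the flux through r = 1 remains.
  have hper : ∀ r : ℝ, g (r, Real.pi) = g (r, -Real.pi) := fun r => by
    simp [hg, polarPoint]
  simp only [hper, sub_self, zero_add] at hint
  have hf0 : ∀ θ : ℝ, f (0, θ) = 0 := fun θ => by simp [hf]
  simp only [hf0, intervalIntegral.integral_zero, sub_zero] at hint
  rw [setIntegral_disc_eq]
  have hset : ∫ p in Set.Ioo (0 : ℝ) 1 ×ˢ Set.Ioo (-Real.pi) Real.pi,
      (p.1 : ℂ) * (pderiv 0 X (polarPoint p) + pderiv 1 Y (polarPoint p)) =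
      ∫ p in Set.Icc ((0 : ℝ), -Real.pi) ((1 : ℝ), Real.pi),
      (p.1 : ℂ) * (pderiv 0 X (polarPoint p) + pderiv 1 Y (polarPoint p)) := by
    refine setIntegral_congr_set ?_
    rw [← Set.Icc_prod_Icc]
    exact Measure.set_prod_ae_eq Ioo_ae_eq_Icc Ioo_ae_eq_Icc
  rw [hset, hint]
  have hper2 := AddCircle.intervalIntegral_preimage (2 * Real.pi) (-Real.pi)
    (fun θ : Bdry => coord 0 (bdryPoint θ) * X (bdryPoint θ) +
        coord 1 (bdryPoint θ) * Y (bdryPoint θ))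
  rw [← hper2, show -Real.pi + 2 * Real.pi = Real.pi by ring]
  refine intervalIntegral.integral_congr fun θ _ => ?_
  simp only [hf, ← polarPoint_one]
  simp [coord, polarPoint]

end DiscRobin

/-! ### Smooth functions in `L²(Ω)`, `L²(∂Ω)` and `H¹(Ω)` -/

namespace DiscRobin

instance isFiniteMeasure_disc : IsFiniteMeasure ((volume : Measure ℂ).restrict disc) :=
  ⟨by rw [Measure.restrict_apply_univ]; exact measure_ball_lt_top⟩

lemma measurableSet_disc : MeasurableSet disc := measurableSet_ball

lemma memLp_disc {φ : ℂ → ℂ} (hφ : Continuous φ) : MemLp φ 2 (volume.restrict disc) := by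
  obtain ⟨C, hC⟩ := (isCompact_closedBall (0 : ℂ) 1).exists_bound_of_continuousOn hφ.continuousOn
  refine MemLp.of_bound hφ.aestronglyMeasurable C ?_
  filter_upwards [ae_restrict_mem measurableSet_disc] with z hz
  exact hC z (Metric.ball_subset_closedBall hz)

lemma memLp_bdry {φ : ℂ → ℂ} (hφ : Continuous φ) :
    MemLp (fun θ : Bdry => φ (bdryPoint θ)) 2 volume :=
  Continuous.memLp_of_hasCompactSupport
    (hφ.comp (continuous_subtype_val.comp AddCircle.continuous_toCircle))
    (HasCompactSupport.of_compactSpace _)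

/-- A continuous function as an element of `L²(Ω)`. -/
noncomputable def discL2 (φ : ℂ → ℂ) (hφ : Continuous φ) : L2Disc := (memLp_disc hφ).toLp φ

/-- The boundary values of a continuous function as an element of `L²(∂Ω)`. -/
noncomputable def bdryL2 (φ : ℂ → ℂ) (hφ : Continuous φ) : L2Bdry := (memLp_bdry hφ).toLp _

lemma coeFn_discL2 {φ : ℂ → ℂ} (hφ : Continuous φ) :
    discL2 φ hφ =ᵐ[volume.restrict disc] φ := MemLp.coeFn_toLp _

lemma coeFn_bdryL2 {φ : ℂ → ℂ} (hφ : Continuous φ) :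
    bdryL2 φ hφ =ᵐ[volume] fun θ => φ (bdryPoint θ) := MemLp.coeFn_toLp _

lemma discL2_congr {φ ψ : ℂ → ℂ} (hφ : Continuous φ) (hψ : Continuous ψ) (h : φ = ψ) :
    discL2 φ hφ = discL2 ψ hψ := by subst h; rfl

lemma inner_discL2 {φ ψ : ℂ → ℂ} (hφ : Continuous φ) (hψ : Continuous ψ) :
    inner ℂ (discL2 φ hφ) (discL2 ψ hψ) = ∫ z in disc, conj (φ z) * ψ z := by
  rw [L2.inner_def]
  refine integral_congr_ae ?_
  filter_upwards [coeFn_discL2 hφ, coeFn_discL2 hψ] with z h1 h2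
  rw [h1, h2, RCLike.inner_apply, mul_comm]

lemma continuous_conj_comp {φ : ℂ → ℂ} (hφ : Continuous φ) : Continuous fun z => conj (φ z) :=
  Complex.continuous_conj.comp hφ

lemma contDiff_conj_comp {φ : ℂ → ℂ} (hφ : ContDiff ℝ ∞ φ) : ContDiff ℝ ∞ fun z => conj (φ z) :=
  (Complex.conjCLE : ℂ ≃L[ℝ] ℂ).contDiff.comp hφ

lemma setIntegral_mul_eq_inner (u : L2Disc) {φ : ℂ → ℂ} (hφ : Continuous φ) :
    ∫ z in disc, u z * φ z = inner ℂ (discL2 _ (continuous_conj_comp hφ)) u := by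
  rw [L2.inner_def]
  refine integral_congr_ae ?_
  filter_upwards [coeFn_discL2 (continuous_conj_comp hφ)] with z h1
  rw [h1, RCLike.inner_apply, Complex.conj_conj]

/-- For a fixed test function both sides of the defining identity are L² inner products, hence
continuous. -/
lemma hasWeakDeriv_of_tendsto {j : Fin 2} {ι : Type*} {l : Filter ι} [l.NeBot]
    {u g : ι → L2Disc} {u' g' : L2Disc} (h : ∀ i, HasWeakDeriv j (u i) (g i))
    (hu : Tendsto u l (𝓝 u')) (hg : Tendsto g l (𝓝 g')) : HasWeakDeriv j u' g' := by
  intro φ hφ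
  have h1 := hφ.smooth.continuous
  have h2 := (contDiff_pderiv (j := j) hφ.smooth).continuous
  have h3 := fun i => h i φ hφ
  simp only [setIntegral_mul_eq_inner _ h1, setIntegral_mul_eq_inner _ h2] at h3 ⊢
  refine tendsto_nhds_unique (tendsto_const_nhds.inner hu) ?_
  simp only [h3]
  exact (tendsto_const_nhds.inner hg).neg

lemma IsTestFunction.eq_zero {φ : ℂ → ℂ} (hφ : IsTestFunction φ) {z : ℂ} (hz : z ∉ disc) :
    φ z = 0 :=
  image_eq_zero_of_notMem_tsupport fun h => hz (hφ.support h)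

lemma IsTestFunction.pderiv_eq_zero {φ : ℂ → ℂ} (hφ : IsTestFunction φ) (j : Fin 2) {z : ℂ}
    (hz : z ∉ disc) : pderiv j φ z = 0 := by
  have h : fderiv ℝ φ z = 0 :=
    image_eq_zero_of_notMem_tsupport fun h => hz (hφ.support (tsupport_fderiv_subset ℝ h))
  rw [pderiv, h]
  rfl

lemma IsTestFunction.hasCompactSupport_pderiv {φ : ℂ → ℂ} (hφ : IsTestFunction φ) (j : Fin 2) :
    HasCompactSupport (pderiv j φ) :=
  HasCompactSupport.of_support_subset_isCompact hφ.compact fun z hz => by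
    by_contra h
    refine hz ?_
    have h : fderiv ℝ φ z = 0 :=
      image_eq_zero_of_notMem_tsupport fun h' => h (tsupport_fderiv_subset ℝ h')
    rw [pderiv, h]
    rfl

lemma IsTestFunction.conj_comp {φ : ℂ → ℂ} (hφ : IsTestFunction φ) :
    IsTestFunction fun z => conj (φ z) := by
  have h : tsupport (fun z => conj (φ z)) = tsupport φ := by
    unfold tsupport
    congr 1
    ext z
    simp
  exact ⟨contDiff_conj_comp hφ.smooth, by rw [HasCompactSupport, h]; exact hφ.compact,
    by rw [h]; exact hφ.support⟩

lemma hasWeakDeriv_smooth (j : Fin 2) {φ : ℂ → ℂ} (hφ : ContDiff ℝ ∞ φ) :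
    HasWeakDeriv j (discL2 φ hφ.continuous) (discL2 (pderiv j φ) (contDiff_pderiv hφ).continuous) := by
  intro η hη
  have hc := hφ.continuous
  have hc' := (contDiff_pderiv (j := j) hφ).continuous
  have he := hη.smooth.continuous
  have he' := (contDiff_pderiv (j := j) hη.smooth).continuous
  have hs := hη.hasCompactSupport_pderiv j
  -- The test function and its derivatives vanish off the disc, so the integrals extend to the whole
  -- plane, where integration by parts has no boundary term.
  have e1 : ∫ z in disc, discL2 φ hφ.continuous z * pderiv j η z = ∫ z, φ z * pderiv j η z := by
    have hz : ∀ z, z ∉ disc → φ z * pderiv j η z = 0 := fun z hz => by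
      rw [hη.pderiv_eq_zero j hz, mul_zero]
    rw [← setIntegral_eq_integral_of_forall_compl_eq_zero hz]
    refine integral_congr_ae ?_
    filter_upwards [coeFn_discL2 hc] with z h1
    rw [h1]
  have e2 : ∫ z in disc, discL2 (pderiv j φ) hc' z * η z = ∫ z, pderiv j φ z * η z := by
    have hz : ∀ z, z ∉ disc → pderiv j φ z * η z = 0 := fun z hz => by
      rw [hη.eq_zero hz, mul_zero]
    rw [← setIntegral_eq_integral_of_forall_compl_eq_zero hz]
    refine integral_congr_ae ?_
    filter_upwards [coeFn_discL2 hc'] with z h1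
    rw [h1]
  rw [e1, e2]
  exact integral_mul_fderiv_eq_neg_fderiv_mul_of_integrable
    ((hc'.mul he).integrable_of_hasCompactSupport hη.compact.mul_left)
    ((hc.mul he').integrable_of_hasCompactSupport hs.mul_left)
    ((hc.mul he).integrable_of_hasCompactSupport hη.compact.mul_left)
    (fun x _ => differentiableAt_of_smooth hφ x)
    (fun x _ => differentiableAt_of_smooth hη.smooth x)

/-- A smooth function on the plane as an element of `H¹(Ω)`. -/
noncomputable def H1.ofSmooth (φ : ℂ → ℂ) (hφ : ContDiff ℝ ∞ φ) : H1 where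
  toL2 := discL2 φ hφ.continuous
  grad j := discL2 (pderiv j φ) (contDiff_pderiv hφ).continuous
  weak j := hasWeakDeriv_smooth j hφ

lemma tendsto_discL2_iff {φ : ℕ → ℂ → ℂ} (hφ : ∀ n, Continuous (φ n)) (u : L2Disc) :
    Tendsto (fun n => discL2 (φ n) (hφ n)) atTop (𝓝 u) ↔
      Tendsto (fun n => eLpNorm (fun z => φ n z - u z) 2 (volume.restrict disc)) atTop (𝓝 0) := by
  have h := Lp.tendsto_Lp_iff_tendsto_eLpNorm'' (fi := atTop) φ (fun n => memLp_disc (hφ n)) u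
    (Lp.memLp u)
  rw [Lp.toLp_coeFn] at h
  exact h

lemma tendsto_bdryL2_iff {φ : ℕ → ℂ → ℂ} (hφ : ∀ n, Continuous (φ n)) (f : L2Bdry) :
    Tendsto (fun n => bdryL2 (φ n) (hφ n)) atTop (𝓝 f) ↔
      Tendsto (fun n => eLpNorm (fun θ : Bdry => φ n (bdryPoint θ) - f θ) 2 volume)
        atTop (𝓝 0) := by
  have h := Lp.tendsto_Lp_iff_tendsto_eLpNorm'' (fi := atTop) (fun n θ => φ n (bdryPoint θ))
    (fun n => memLp_bdry (hφ n)) f (Lp.memLp f)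
  rw [Lp.toLp_coeFn] at h
  exact h

/-- Recasts the trace as convergence in Hilbert spaces, so that identities for smooth functions pass
to the limit by continuity of inner products. -/
lemma isTraceL2_iff (u : H1) (f : L2Bdry) :
    IsTraceL2 u f ↔ ∃ (φ : ℕ → ℂ → ℂ) (hφ : ∀ n, ContDiff ℝ ∞ (φ n)),
      Tendsto (fun n => discL2 (φ n) (hφ n).continuous) atTop (𝓝 u.toL2) ∧
      (∀ j, Tendsto (fun n => discL2 (pderiv j (φ n)) (contDiff_pderiv (hφ n)).continuous) atTop
        (𝓝 (u.grad j))) ∧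
      Tendsto (fun n => bdryL2 (φ n) (hφ n).continuous) atTop (𝓝 f) := by
  constructor
  · rintro ⟨φ, hφ, h1, h2, h3⟩
    exact ⟨φ, hφ, (tendsto_discL2_iff _ _).2 h1, fun j => (tendsto_discL2_iff _ _).2 (h2 j),
      (tendsto_bdryL2_iff _ _).2 h3⟩
  · rintro ⟨φ, hφ, h1, h2, h3⟩
    exact ⟨φ, hφ, (tendsto_discL2_iff _ _).1 h1, fun j => (tendsto_discL2_iff _ _).1 (h2 j),
      (tendsto_bdryL2_iff _ _).1 h3⟩

lemma isTraceL2_ofSmooth (φ : ℂ → ℂ) (hφ : ContDiff ℝ ∞ φ) :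
    IsTraceL2 (H1.ofSmooth φ hφ) (bdryL2 φ hφ.continuous) :=
  (isTraceL2_iff _ _).2 ⟨fun _ => φ, fun _ => hφ, tendsto_const_nhds, fun _ => tendsto_const_nhds,
    tendsto_const_nhds⟩

lemma integrableOn_disc {φ : ℂ → ℂ} (hφ : Continuous φ) : IntegrableOn φ disc :=
  (hφ.continuousOn.integrableOn_compact (isCompact_closedBall (0 : ℂ) 1)).mono_set
    Metric.ball_subset_closedBall

/-- Green's first identity for smooth functions. -/
lemma green_smooth {φ ψ : ℂ → ℂ} (hφ : ContDiff ℝ ∞ φ) (hψ : ContDiff ℝ ∞ ψ) {c : ℂ}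
    (hΔ : ∀ z, pderiv 0 (pderiv 0 ψ) z + pderiv 1 (pderiv 1 ψ) z = c * ψ z) :
    (∑ j, inner ℂ (discL2 (pderiv j φ) (contDiff_pderiv hφ).continuous)
      (discL2 (pderiv j ψ) (contDiff_pderiv hψ).continuous)) =
    -c * inner ℂ (discL2 φ hφ.continuous) (discL2 ψ hψ.continuous) +
      ∫ θ : Bdry, conj (φ (bdryPoint θ)) * (coord 0 (bdryPoint θ) * pderiv 0 ψ (bdryPoint θ) +
        coord 1 (bdryPoint θ) * pderiv 1 ψ (bdryPoint θ)) := by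
  have hφc := contDiff_conj_comp hφ
  -- The vector field is the conjugate of φ times the gradient of ψ.
  have hd := integral_divergence_disc (hφc.mul (contDiff_pderiv (j := 0) hψ))
    (hφc.mul (contDiff_pderiv (j := 1) hψ))
  have e1 : ∀ z, pderiv 0 (fun z => conj (φ z) * pderiv 0 ψ z) z +
      pderiv 1 (fun z => conj (φ z) * pderiv 1 ψ z) z =
      conj (pderiv 0 φ z) * pderiv 0 ψ z + conj (pderiv 1 φ z) * pderiv 1 ψ z +
        c * (conj (φ z) * ψ z) := fun z => by
    rw [pderiv_mul (differentiableAt_of_smooth hφc z)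
        (differentiableAt_of_smooth (contDiff_pderiv hψ) z),
      pderiv_mul (differentiableAt_of_smooth hφc z)
        (differentiableAt_of_smooth (contDiff_pderiv hψ) z), pderiv_conj, pderiv_conj]
    linear_combination conj (φ z) * hΔ z
  have i : ∀ {f g : ℂ → ℂ}, ContDiff ℝ ∞ f → ContDiff ℝ ∞ g →
      Integrable (fun z => conj (f z) * g z) (volume.restrict disc) := fun hf hg =>
    integrableOn_disc ((contDiff_conj_comp hf).mul hg).continuous
  simp only [e1] at hd
  have e2 := integral_add ((i (contDiff_pderiv (j := 0) hφ) (contDiff_pderiv (j := 0) hψ)).add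
    (i (contDiff_pderiv (j := 1) hφ) (contDiff_pderiv (j := 1) hψ))) ((i hφ hψ).const_mul c)
  simp only [Pi.add_apply] at e2
  rw [e2, integral_add (i (contDiff_pderiv (j := 0) hφ) (contDiff_pderiv (j := 0) hψ))
    (i (contDiff_pderiv (j := 1) hφ) (contDiff_pderiv (j := 1) hψ)), integral_const_mul] at hd
  rw [Fin.sum_univ_two, inner_discL2, inner_discL2, inner_discL2]
  have e3 : ∀ θ : Bdry, conj (φ (bdryPoint θ)) *
      (coord 0 (bdryPoint θ) * pderiv 0 ψ (bdryPoint θ) +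
        coord 1 (bdryPoint θ) * pderiv 1 ψ (bdryPoint θ)) =
      coord 0 (bdryPoint θ) * (conj (φ (bdryPoint θ)) * pderiv 0 ψ (bdryPoint θ)) +
      coord 1 (bdryPoint θ) * (conj (φ (bdryPoint θ)) * pderiv 1 ψ (bdryPoint θ)) := fun θ => by
    ring
  simp only [e3]
  rw [← hd]
  ring

/-! ### Fourier modes on the boundary -/

/-- `e^{ikθ}` as an element of `L²(∂Ω)`. -/
noncomputable def fourierL2 (k : ℤ) : L2Bdry :=
  ((fourier k : C(Bdry, ℂ)).continuous.memLp_of_hasCompactSupport (μ := volume)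
    (HasCompactSupport.of_compactSpace _)).toLp (fourier k)

lemma coeFn_fourierL2 (k : ℤ) : fourierL2 k =ᵐ[volume] fourier k := MemLp.coeFn_toLp _

/-- The weight `(1 + k²)^{1/4}`. -/
noncomputable def weight (k : ℤ) : ℝ := (1 + (k : ℝ) ^ 2) ^ (1 / 4 : ℝ)

lemma weight_positive (k : ℤ) : 0 < weight k := weight_pos k

lemma weight_ne_zero (k : ℤ) : (weight k : ℂ) ≠ 0 := 
  Complex.ofReal_ne_zero.2 (weight_positive k).ne'

lemma weight_pow_four (k : ℤ) : weight k ^ 4 = 1 + (k : ℝ) ^ 2 := by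
  rw [weight, ← Real.rpow_natCast, ← Real.rpow_mul (by positivity)]
  norm_num

/-- Since 1 + k² ≤ (|k| + 1)². With `natAbs_le_weight_sq` this places `weight k ^ 2` between |k| and
|k| + 1, which makes the two interchangeable in the asymptotics. -/
lemma weight_sq_le (k : ℤ) : weight k ^ 2 ≤ k.natAbs + 1 := by
  have h := weight_pow_four k
  have h2 : ((k.natAbs : ℝ)) ^ 2 = (k : ℝ) ^ 2 := by
    rw [Nat.cast_natAbs, Int.cast_abs, sq_abs]
  have h3 : (0 : ℝ) ≤ k.natAbs := by positivity
  refine abs_le_of_sq_le_sq' ?_ (by positivity) |>.2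
  nlinarith

lemma natAbs_le_weight_sq (k : ℤ) : (k.natAbs : ℝ) ≤ weight k ^ 2 := by
  have h := weight_pow_four k
  have h2 : ((k.natAbs : ℝ)) ^ 2 = (k : ℝ) ^ 2 := by
    rw [Nat.cast_natAbs, Int.cast_abs, sq_abs]
  refine abs_le_of_sq_le_sq' ?_ (by positivity) |>.2
  nlinarith

lemma wcoeff_fourierL2 (k : ℤ) : wcoeff (fourierL2 k) = Pi.single k (weight k : ℂ) := by
  funext m
  have h : fourierCoeff (fourierL2 k) = Pi.single k (1 : ℂ) := by
    rw [← fourierCoeff_fourier (T := 2 * Real.pi)]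
    exact fourierCoeff_congr_ae (ae_haar_of_ae (coeFn_fourierL2 k))
  rw [wcoeff, h]
  by_cases hm : m = k
  · subst hm; simp [weight]
  · simp [hm]

/-- `e^{ikθ}` as an element of `H^{1/2}(∂Ω)`. -/
noncomputable def fourierHalf (k : ℤ) : HHalf :=
  ⟨fourierL2 k, by
    change Memℓp (wcoeff (fourierL2 k)) 2
    have h := lp.memℓp (lp.single (E := fun _ : ℤ => ℂ) 2 k (weight k : ℂ))
    rw [lp.coeFn_single] at h
    rw [wcoeff_fourierL2]
    exact h⟩

lemma incl_fourierHalf (k : ℤ) : incl (fourierHalf k) = fourierL2 k := rfl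

lemma toSeq_fourierHalf (k : ℤ) :
    HHalf.toSeq (fourierHalf k) = lp.single 2 k (weight k : ℂ) := by
  ext m
  rw [HHalf.toSeq_apply]
  change wcoeff (fourierL2 k) m = _
  rw [wcoeff_fourierL2, lp.coeFn_single]

/-- The coordinate expansion in ℓ² pulled back by the isometry `equivSeq`. The division appears
because `fourierHalf k` has norm `weight k`. -/
lemma hasSum_fourierHalf (f : HHalf) :
    HasSum (fun k => (HHalf.toSeq f k / weight k) • fourierHalf k) f := by
  have h := (lp.hasSum_single (by norm_num) (HHalf.toSeq f)).mapL
    (HHalf.equivSeq.symm.toContinuousLinearEquiv : _ →L[ℂ] HHalf)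
  have e : ∀ k, (HHalf.toSeq f k / weight k) • fourierHalf k =
      HHalf.equivSeq.symm (lp.single 2 k (HHalf.toSeq f k)) := fun k => by
    rw [LinearIsometryEquiv.eq_symm_apply]
    change HHalf.toSeq _ = _
    rw [map_smul, toSeq_fourierHalf, ← lp.single_smul, smul_eq_mul,
      div_mul_cancel₀ _ (weight_ne_zero k)]
  have e2 : HHalf.equivSeq.symm (HHalf.toSeq f) = f := HHalf.equivSeq.symm_apply_apply f
  simp only [e]
  have h' : HasSum (fun k => HHalf.equivSeq.symm (lp.single 2 k (HHalf.toSeq f k)))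
    (HHalf.equivSeq.symm (HHalf.toSeq f)) := h
  rwa [e2] at h'

lemma inner_HHalf (f g : HHalf) : inner ℂ f g = inner ℂ (HHalf.toSeq f) (HHalf.toSeq g) := rfl

lemma inner_fourierHalf (k : ℤ) (f : HHalf) :
    inner ℂ (fourierHalf k) f = weight k * HHalf.toSeq f k := by
  rw [inner_HHalf, toSeq_fourierHalf, lp.inner_single_left, RCLike.inner_apply, Complex.conj_ofReal,
    mul_comm]

lemma riesz_apply (f g : HHalf) : riesz f g = inner ℂ g f := rfl

lemma apply_eq_inner (ψ : HMinusHalf) (g : HHalf) : ψ g = inner ℂ g (riesz.symm ψ) := by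
  rw [← riesz_apply, LinearIsometryEquiv.apply_symm_apply]

lemma apply_fourierHalf (ψ : HMinusHalf) (k : ℤ) :
    ψ (fourierHalf k) = weight k * HHalf.toSeq (riesz.symm ψ) k := by
  rw [apply_eq_inner, inner_fourierHalf]

/-- The factor 2π is the ratio of arc length to the normalized measure defining Fourier
coefficients; dividing by `weight k` undoes the weight built into `toSeq`. -/
lemma inner_fourierL2 (k : ℤ) (f : HHalf) :
    inner ℂ (fourierL2 k) (incl f) = 2 * Real.pi / weight k * HHalf.toSeq f k := by
  have hv (F : Bdry → ℂ) : ∫ θ, F θ = (2 * Real.pi : ℝ) • ∫ θ, F θ ∂AddCircle.haarAddCircle := by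
    rw [AddCircle.volume_eq_smul_haarAddCircle, integral_smul_measure,
      ENNReal.toReal_ofReal Real.two_pi_pos.le]
  rw [L2.inner_def, hv, HHalf.toSeq_apply, wcoeff]
  have h : ∫ θ, inner ℂ (fourierL2 k θ) (incl f θ) ∂AddCircle.haarAddCircle =
      fourierCoeff (HHalf.toL2 f) k := by
    rw [fourierCoeff]
    refine integral_congr_ae ?_
    filter_upwards [ae_haar_of_ae (coeFn_fourierL2 k)] with θ h1
    rw [h1, RCLike.inner_apply, fourier_neg, smul_eq_mul, mul_comm]
    rfl
  have hw := weight_ne_zero k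
  rw [h, Complex.real_smul]
  change _ = 2 * (Real.pi : ℂ) / weight k * (weight k * _)
  field_simp
  push_cast
  ring

/-- `J` in Fourier coordinates. -/
lemma toSeq_inclJ (f : HHalf) (k : ℤ) :
    HHalf.toSeq (riesz.symm (inclJ f)) k = 2 * Real.pi / weight k ^ 2 * HHalf.toSeq f k := by
  have h := apply_fourierHalf (inclJ f) k
  rw [inclJ_apply, incl_fourierHalf, inner_fourierL2] at h
  have hw := weight_ne_zero k
  field_simp at h ⊢
  linear_combination -h

end DiscRobin

/-! ### Series of separated solutions -/

namespace DiscRobin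

lemma discL2_add {φ ψ : ℂ → ℂ} (hφ : Continuous φ) (hψ : Continuous ψ) :
    discL2 (fun z => φ z + ψ z) (hφ.add hψ) = discL2 φ hφ + discL2 ψ hψ := rfl

lemma discL2_const_mul (a : ℂ) {φ : ℂ → ℂ} (hφ : Continuous φ) :
    discL2 (fun z => a * φ z) (continuous_const.mul hφ) = a • discL2 φ hφ := rfl

lemma bdryL2_add {φ ψ : ℂ → ℂ} (hφ : Continuous φ) (hψ : Continuous ψ) :
    bdryL2 (fun z => φ z + ψ z) (hφ.add hψ) = bdryL2 φ hφ + bdryL2 ψ hψ := rfl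

lemma bdryL2_const_mul (a : ℂ) {φ : ℂ → ℂ} (hφ : Continuous φ) :
    bdryL2 (fun z => a * φ z) (continuous_const.mul hφ) = a • bdryL2 φ hφ := rfl

section sums

variable {ι : Type*} (S : Finset ι) (a : ι → ℂ) {φ : ι → ℂ → ℂ}

lemma discL2_sum (hφ : ∀ i, Continuous (φ i)) (h : Continuous fun z => ∑ i ∈ S, a i * φ i z) :
    discL2 (fun z => ∑ i ∈ S, a i * φ i z) h = ∑ i ∈ S, a i • discL2 (φ i) (hφ i) := by
  classical
  induction S using Finset.induction_on with
  | empty => simp only [Finset.sum_empty]; rfl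
  | insert i S hi ih =>
    have h2 : Continuous fun z => ∑ i ∈ S, a i * φ i z :=
      continuous_finsetSum _ fun i _ => continuous_const.mul (hφ i)
    rw [Finset.sum_insert hi, ← ih h2, ← discL2_const_mul]
    refine Eq.trans ?_ (discL2_add (φ := fun z => a i * φ i z) (continuous_const.mul (hφ i)) h2)
    congr 1
    exact funext fun z => Finset.sum_insert hi

lemma bdryL2_sum (hφ : ∀ i, Continuous (φ i)) (h : Continuous fun z => ∑ i ∈ S, a i * φ i z) :
    bdryL2 (fun z => ∑ i ∈ S, a i * φ i z) h = ∑ i ∈ S, a i • bdryL2 (φ i) (hφ i) := by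
  classical
  induction S using Finset.induction_on with
  | empty => simp only [Finset.sum_empty]; rfl
  | insert i S hi ih =>
    have h2 : Continuous fun z => ∑ i ∈ S, a i * φ i z :=
      continuous_finsetSum _ fun i _ => continuous_const.mul (hφ i)
    rw [Finset.sum_insert hi, ← ih h2, ← bdryL2_const_mul]
    refine Eq.trans ?_ (bdryL2_add (φ := fun z => a i * φ i z) (continuous_const.mul (hφ i)) h2)
    congr 1
    exact funext fun z => Finset.sum_insert hi

lemma contDiff_sum_mul (hφ : ∀ i, ContDiff ℝ ∞ (φ i)) :
    ContDiff ℝ ∞ fun z => ∑ i ∈ S, a i * φ i z :=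
  ContDiff.sum fun i _ => contDiff_const.mul (hφ i)

lemma pderiv_sum (hφ : ∀ i, ContDiff ℝ ∞ (φ i)) (j : Fin 2) :
    pderiv j (fun z => ∑ i ∈ S, a i * φ i z) = fun z => ∑ i ∈ S, a i * pderiv j (φ i) z := by
  classical
  induction S using Finset.induction_on with
  | empty =>
    funext z
    simp [pderiv]
  | insert i S hi ih =>
    funext z
    simp only [Finset.sum_insert hi]
    rw [pderiv_add ((differentiableAt_of_smooth (hφ i) z).const_mul _)
      (differentiableAt_of_smooth (contDiff_sum_mul S a hφ) z),
      pderiv_const_mul _ (differentiableAt_of_smooth (hφ i) z), congrFun ih z]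

end sums

/-- The separated solution as an element of `H¹(Ω)`. -/
noncomputable def modeH1 (c : ℝ) (k : ℤ) : H1 := H1.ofSmooth (mode c k) (contDiff_mode c k)

lemma bdryL2_mode (c : ℝ) (k : ℤ) :
    bdryL2 (mode c k) (contDiff_mode c k).continuous = (modeVal c k : ℂ) • fourierL2 k := by
  refine Lp.ext ?_
  filter_upwards [coeFn_bdryL2 (contDiff_mode c k).continuous,
    Lp.coeFn_smul (modeVal c k : ℂ) (fourierL2 k), coeFn_fourierL2 k] with θ h1 h2 h3
  rw [h1, h2, Pi.smul_apply, h3, mode_bdryPoint, smul_eq_mul]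

lemma hasTrace_mode (c : ℝ) (k : ℤ) :
    HasTrace (modeH1 c k) ((modeVal c k : ℂ) • fourierHalf k) := by
  rw [HasTrace, map_smul, incl_fourierHalf, ← bdryL2_mode]
  exact isTraceL2_ofSmooth _ _

/-- Green's first identity for a separated solution and an `H¹` function. -/
lemma green_mode (c : ℝ) (k : ℤ) {v : H1} {f : L2Bdry} (hv : IsTraceL2 v f) :
    ∑ j, inner ℂ (v.grad j) ((modeH1 c k).grad j) =
      -(4 * c) * inner ℂ v.toL2 (modeH1 c k).toL2 + modeDeriv c k * inner ℂ f (fourierL2 k) := by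
  obtain ⟨φ, hφ, h1, h2, h3⟩ := (isTraceL2_iff _ _).1 hv
  have hn : ∀ n, ∑ j, inner ℂ (discL2 (pderiv j (φ n)) (contDiff_pderiv (hφ n)).continuous)
      ((modeH1 c k).grad j) =
      -(4 * c) * inner ℂ (discL2 (φ n) (hφ n).continuous) (modeH1 c k).toL2 +
        modeDeriv c k * inner ℂ (bdryL2 (φ n) (hφ n).continuous) (fourierL2 k) := fun n => by
    have h := green_smooth (hφ n) (contDiff_mode c k) (laplacian_mode c k)
    refine h.trans ?_
    congr 1
    rw [L2.inner_def, ← integral_const_mul]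
    refine integral_congr_ae ?_
    filter_upwards [coeFn_bdryL2 (hφ n).continuous, coeFn_fourierL2 k] with θ e1 e2
    rw [e1, e2, normalDeriv_mode, RCLike.inner_apply]
    ring
  -- Both sides are continuous along the smooth sequence that approximates `v`, its gradient and its
  -- trace.
  refine tendsto_nhds_unique (f := fun n => ∑ j, inner ℂ
    (discL2 (pderiv j (φ n)) (contDiff_pderiv (hφ n)).continuous) ((modeH1 c k).grad j))
    (tendsto_finsetSum _ fun j _ => (h2 j).inner tendsto_const_nhds) ?_
  simp only [hn]
  exact ((h1.inner tendsto_const_nhds).const_mul _).add ((h3.inner tendsto_const_nhds).const_mul _)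

/-- The relation 4c = γ - lam turns Δu = 4cu into (-Δ + γ)u = lam·u; the last term is the conormal
derivative of the mode paired with the trace of `v`. -/
lemma form_mode {γ lam c : ℝ} (hc : 4 * c = γ - lam) (k : ℤ) {v : H1} {h : HHalf}
    (hv : HasTrace v h) :
    form γ (modeH1 c k) v = lam * inner ℂ v.toL2 (modeH1 c k).toL2 +
      modeDeriv c k * inner ℂ (incl h) (fourierL2 k) := by
  have hc' : (4 : ℂ) * c = γ - lam := by exact_mod_cast hc
  rw [form, green_mode c k hv]
  linear_combination (-inner ℂ v.toL2 (modeH1 c k).toL2) * hc'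

lemma inner_fourierL2_right (h : HHalf) (k : ℤ) :
    inner ℂ (incl h) (fourierL2 k) = 2 * Real.pi / weight k * conj (HHalf.toSeq h k) := by
  rw [← inner_conj_symm, inner_fourierL2]
  simp only [map_mul, map_div₀, Complex.conj_ofReal, map_ofNat]

lemma inner_fourierL2_self (k : ℤ) : inner ℂ (fourierL2 k) (fourierL2 k) = 2 * Real.pi := by
  have h := inner_fourierL2_right (fourierHalf k) k
  rw [incl_fourierHalf, toSeq_fourierHalf, lp.coeFn_single] at h
  rw [h]
  have := weight_ne_zero k
  simp
  field_simp

lemma inner_fourierL2_ne {j k : ℤ} (h : j ≠ k) : inner ℂ (fourierL2 j) (fourierL2 k) = 0 := by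
  have h' := inner_fourierL2_right (fourierHalf j) k
  rw [incl_fourierHalf, toSeq_fourierHalf, lp.coeFn_single] at h'
  rw [h']
  simp [h.symm]

/-! ### Orthogonality and H¹ norms of the separated solutions. -/

lemma mode_mul {a : ℂ} {θ : Bdry} (ha : a = bdryPoint θ) (c : ℝ) (k : ℤ) (z : ℂ) :
    mode c k (a * z) = fourier k θ * mode c k z := by
  have h : angularCoord k (a * z) = angularCoord k a * angularCoord k z := by
    unfold angularCoord; split_ifs <;> simp
  rw [mode, mode, h, mul_pow, ha, angularCoord_bdryPoint_pow, map_mul, normSq_bdryPoint, one_mul,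
    mul_assoc]

/-- Rotation by the angle θ = π/(k - j) preserves the disc and its measure, but multiplies the
integrand by e^{i(k-j)θ} = -1, so the integral equals its own negative. -/
lemma inner_mode_ne (c : ℝ) {j k : ℤ} (h : j ≠ k) :
    inner ℂ (modeH1 c j).toL2 (modeH1 c k).toL2 = 0 := by
  refine (inner_discL2 (contDiff_mode c j).continuous (contDiff_mode c k).continuous).trans ?_
  set θ : Bdry := ((2 * Real.pi / 2 / ((k - j : ℤ) : ℝ) : ℝ) : Bdry) with hθ
  have e : fourier (k - j) θ = (-1 : ℂ) := by
    have := fourier_add_half_inv_index (sub_ne_zero.2 h.symm) Real.two_pi_pos 0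
    rw [zero_add, ← hθ] at this
    simpa using this
  have e2 : conj (fourier j θ : ℂ) * fourier k θ = -1 := by
    rw [← e, ← fourier_neg, ← fourier_add, neg_add_eq_sub]
  let R : ℂ ≃ₗᵢ[ℝ] ℂ := rotation (AddCircle.toCircle θ)
  have hR : ∀ z, R z = bdryPoint θ * z := fun z => rotation_apply _ _
  have hpre : R ⁻¹' disc = disc := by
    ext z
    simp [disc]
  have h1 := (R.measurePreserving).setIntegral_preimage_emb
    R.toHomeomorph.measurableEmbedding (fun z => conj (mode c j z) * mode c k z) disc
  rw [hpre] at h1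
  have h2 : ∀ z, conj (mode c j (R z)) * mode c k (R z) = -(conj (mode c j z) * mode c k z) := by
    intro z
    rw [hR, mode_mul rfl, mode_mul rfl, map_mul]
    linear_combination (conj (mode c j z) * mode c k z) * e2
  simp only [h2] at h1
  rw [integral_neg] at h1
  exact self_eq_neg.1 h1.symm

/-- A function together with its gradient, as an element of `L²(Ω)³`. -/
noncomputable def H1.jet (u : H1) : PiLp 2 (fun _ : Fin 3 => L2Disc) :=
  WithLp.toLp 2 ![u.toL2, u.grad 0, u.grad 1]

lemma inner_jet (u v : H1) : inner ℂ u.jet v.jet =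
    inner ℂ u.toL2 v.toL2 + ∑ j, inner ℂ (u.grad j) (v.grad j) := by
  rw [PiLp.inner_apply, Fin.sum_univ_three, Fin.sum_univ_two, add_assoc]
  rfl

/-- Green's identity replaces the gradient terms by L² inner products on the disc and on the circle;
orthogonality and the norm bound in H¹ both follow from this formula. -/
lemma inner_jet_mode (c : ℝ) (j k : ℤ) : inner ℂ (modeH1 c j).jet (modeH1 c k).jet =
    (1 - 4 * c) * inner ℂ (modeH1 c j).toL2 (modeH1 c k).toL2 +
      modeDeriv c k * (modeVal c j * inner ℂ (fourierL2 j) (fourierL2 k)) := by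
  rw [inner_jet, green_mode c k (hasTrace_mode c j), map_smul, incl_fourierHalf, inner_smul_left,
    Complex.conj_ofReal]
  ring

lemma inner_jet_mode_ne (c : ℝ) {j k : ℤ} (h : j ≠ k) :
    inner ℂ (modeH1 c j).jet (modeH1 c k).jet = 0 := by
  rw [inner_jet_mode, inner_mode_ne c h, inner_fourierL2_ne h]
  simp

lemma abs_besselG_le_exp (c : ℝ) (k : ℕ) {x : ℝ} (h0 : 0 ≤ x) (h1 : x ≤ 1) :
    |besselG c k x| ≤ Real.exp |c| := by
  refine (abs_besselG_le c k x).trans (Real.exp_le_exp.2 ?_)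
  rw [abs_mul, abs_of_nonneg h0]
  exact mul_le_of_le_one_right (abs_nonneg c) h1

lemma norm_mode_le (c : ℝ) (k : ℤ) {z : ℂ} (hz : z ∈ disc) : ‖mode c k z‖ ≤ Real.exp |c| := by
  have h : ‖z‖ < 1 := by simpa [disc] using hz
  have h2 : Complex.normSq z ≤ 1 := by
    rw [Complex.normSq_eq_norm_sq]
    exact pow_le_one₀ (norm_nonneg z) h.le
  rw [mode, norm_mul, norm_pow, norm_angularCoord, Complex.norm_real, Real.norm_eq_abs]
  exact (mul_le_of_le_one_left (abs_nonneg _) (pow_le_one₀ (norm_nonneg z) h.le)).trans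
    (abs_besselG_le_exp c _ (Complex.normSq_nonneg z) h2)

lemma abs_modeVal_le (c : ℝ) (k : ℤ) : |modeVal c k| ≤ Real.exp |c| :=
  abs_besselG_le_exp c _ zero_le_one le_rfl

lemma one_le_weight_sq (k : ℤ) : 1 ≤ weight k ^ 2 := one_le_pow₀ (one_le_weight k)

lemma abs_modeDeriv_le (c : ℝ) (k : ℤ) :
    |modeDeriv c k| ≤ (1 + 2 * |c|) * Real.exp |c| * weight k ^ 2 := by
  have h1 := abs_besselG_le_exp c k.natAbs zero_le_one le_rfl
  have h2 := abs_besselG_le_exp c (k.natAbs + 1) zero_le_one le_rfl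
  have h3 := natAbs_le_weight_sq k
  have h4 := one_le_weight_sq k
  have h5 : |c / (k.natAbs + 1)| ≤ |c| := by
    rw [abs_div, abs_of_pos (by positivity : (0 : ℝ) < (k.natAbs : ℝ) + 1)]
    exact div_le_self (abs_nonneg c) (by linarith [Nat.cast_nonneg (α := ℝ) k.natAbs])
  calc |modeDeriv c k| ≤ |(k.natAbs : ℝ) * besselG c k.natAbs 1| +
        |2 * (c / (k.natAbs + 1) * besselG c (k.natAbs + 1) 1)| := abs_add_le _ _
    _ = k.natAbs * |besselG c k.natAbs 1| +
        2 * (|c / (k.natAbs + 1)| * |besselG c (k.natAbs + 1) 1|) := by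
      rw [abs_mul, abs_mul, abs_mul, Nat.abs_cast, abs_two]
    _ ≤ weight k ^ 2 * Real.exp |c| + 2 * (|c| * Real.exp |c|) * weight k ^ 2 := by
      refine add_le_add (by gcongr) ((mul_le_mul_of_nonneg_left (by gcongr) zero_le_two).trans
        (le_mul_of_one_le_right (by positivity) h4))
    _ = _ := by ring

/-- The growth comes from the boundary term 2πD_kF_k, where D_k = O(w_k²); the L² norms of the modes
stay bounded. This is what the factor `b k / weight k` compensates for in the series below. -/
lemma exists_norm_jet_mode_le (c : ℝ) :
    ∃ C, ∀ k, ‖(modeH1 c k).jet‖ ^ 2 ≤ C * weight k ^ 2 := by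
  obtain ⟨A, hA⟩ : ∃ A, ∀ k, ‖(modeH1 c k).toL2‖ ≤ A :=
    ⟨_, fun k => Lp.norm_le_of_ae_bound (Real.exp_pos |c|).le (by
      filter_upwards [coeFn_discL2 (contDiff_mode c k).continuous,
        ae_restrict_mem measurableSet_disc] with z h1 h2
      exact (congrArg norm h1).trans_le (norm_mode_le c k h2))⟩
  refine ⟨|1 - 4 * c| * A ^ 2 +
    (1 + 2 * |c|) * Real.exp |c| * (Real.exp |c| * (2 * Real.pi)), fun k => ?_⟩
  have h1 : ‖(modeH1 c k).jet‖ ^ 2 ≤ |1 - 4 * c| * ‖(modeH1 c k).toL2‖ ^ 2 +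
      |modeDeriv c k| * (|modeVal c k| * (2 * Real.pi)) := by
    have h := inner_jet_mode c k k
    rw [inner_fourierL2_self, inner_self_eq_norm_sq_to_K, inner_self_eq_norm_sq_to_K] at h
    have h' : ‖(modeH1 c k).jet‖ ^ 2 = (1 - 4 * c) * ‖(modeH1 c k).toL2‖ ^ 2 +
      modeDeriv c k * (modeVal c k * (2 * Real.pi)) := by
      apply Complex.ofReal_injective
      push_cast
      exact h
    rw [h']
    refine (le_abs_self _).trans ((abs_add_le _ _).trans_eq ?_)
    rw [abs_mul, abs_mul, abs_mul, abs_of_pos Real.two_pi_pos,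
      abs_of_nonneg (sq_nonneg ‖(modeH1 c k).toL2‖)]
  refine h1.trans ?_
  rw [add_mul]
  refine add_le_add ?_ ?_
  · refine le_trans ?_ (le_mul_of_one_le_right (by positivity) (one_le_weight_sq k))
    gcongr
    exact hA k
  · calc _ ≤ (1 + 2 * |c|) * Real.exp |c| * weight k ^ 2 * (Real.exp |c| * (2 * Real.pi)) := by
          gcongr
          · exact abs_modeDeriv_le c k
          · exact abs_modeVal_le c k
      _ = _ := by ring

/-- Passing to the spans of the vectors avoids normalizing them and allows some of them to be zero.
-/
lemma summable_of_orthogonal {E : Type*} [NormedAddCommGroup E] [InnerProductSpace ℂ E]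
    [CompleteSpace E] {ι : Type*} {x : ι → E} (hx : Pairwise fun i j => inner ℂ (x i) (x j) = 0)
    (h : Summable fun i => ‖x i‖ ^ 2) : Summable x := by
  have hV : OrthogonalFamily ℂ (fun i => Submodule.span ℂ {x i})
      fun i => (Submodule.span ℂ {x i}).subtypeₗᵢ := by
    intro i j hij v w
    obtain ⟨a, ha⟩ := Submodule.mem_span_singleton.1 v.2
    obtain ⟨b, hb⟩ := Submodule.mem_span_singleton.1 w.2
    simp only [Submodule.coe_subtypeₗᵢ, Submodule.subtype_apply]
    rw [← ha, ← hb, inner_smul_left, inner_smul_right, hx hij]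
    simp
  exact (hV.summable_iff_norm_sq_summable
    fun i => ⟨x i, Submodule.mem_span_singleton_self _⟩).2 h

lemma hasSum_of_eq {ι E : Type*} [AddCommMonoid E] [TopologicalSpace E] {f g : ι → E}
    {a : E} (h : HasSum f a) (hfg : ∀ i, g i = f i) : HasSum g a :=
  (funext hfg : g = f) ▸ h

lemma exists_hasSum_mode (c : ℝ) (b : lp (fun _ : ℤ => ℂ) 2) :
    ∃ u : H1, HasSum (fun k => (b k / weight k) • (modeH1 c k).toL2) u.toL2 ∧
      ∀ j, HasSum (fun k => (b k / weight k) • (modeH1 c k).grad j) (u.grad j) := by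
  obtain ⟨C, hC⟩ := exists_norm_jet_mode_le c
  have hb : Summable fun k => ‖b k‖ ^ 2 := by
    have := (lp.memℓp b).summable (by norm_num)
    simpa using this
  have hs : Summable fun k => (b k / weight k) • (modeH1 c k).jet := by
    refine summable_of_orthogonal (fun i j hij => ?_) ?_
    · beta_reduce
      rw [inner_smul_left, inner_smul_right, inner_jet_mode_ne c hij]
      simp
    · refine Summable.of_nonneg_of_le (fun k => sq_nonneg _) (fun k => ?_) (hb.mul_right C)
      rw [norm_smul, mul_pow, norm_div, Complex.norm_real, Real.norm_of_nonneg (weight_positive k).le,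
        div_pow, div_mul_eq_mul_div, div_le_iff₀ (pow_pos (weight_positive k) 2), mul_assoc]
      gcongr
      exact hC k
  have hp : ∀ i : Fin 3, HasSum (fun k => (b k / weight k) • (modeH1 c k).jet i)
      ((∑' k, (b k / weight k) • (modeH1 c k).jet) i) := fun i =>
    hs.hasSum.mapL (PiLp.proj (𝕜 := ℂ) 2 (fun _ : Fin 3 => L2Disc) i)
  set w := ∑' k, (b k / weight k) • (modeH1 c k).jet with hw
  have h0 : HasSum (fun k => (b k / weight k) • (modeH1 c k).toL2) (w 0) := hp 0
  have h1 : ∀ j : Fin 2, HasSum (fun k => (b k / weight k) • (modeH1 c k).grad j)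
      (w j.succ) := by
    intro j
    fin_cases j
    · exact hp 1
    · exact hp 2
  refine ⟨⟨w 0, fun j => w j.succ, fun j => ?_⟩, h0, h1⟩
  -- Finite partial sums are smooth, and weak derivatives survive L² limits.
  refine hasWeakDeriv_of_tendsto (fun S => ?_) h0 (h1 j)
  have hd := hasWeakDeriv_smooth j
    (contDiff_sum_mul S (fun k => b k / weight k) (fun k => contDiff_mode c k))
  rw [discL2_sum _ _ fun k => (contDiff_mode c k).continuous,
    discL2_congr _ (contDiff_sum_mul S _ fun k => contDiff_pderiv (j := j)
      (contDiff_mode c k)).continuous (pderiv_sum S _ (fun k => contDiff_mode c k) j),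
    discL2_sum _ _ fun k => (contDiff_pderiv (contDiff_mode c k)).continuous] at hd
  exact hd

/-! ### Trace and Green's identity for series of modes. -/

section series

variable {c : ℝ} {b : lp (fun _ : ℤ => ℂ) 2} {u : H1}

lemma hasTrace_of_hasSum_mode
    (hu : HasSum (fun k => (b k / weight k) • (modeH1 c k).toL2) u.toL2)
    (hg : ∀ j, HasSum (fun k => (b k / weight k) • (modeH1 c k).grad j) (u.grad j))
    {f : HHalf} (hf : ∀ k, HHalf.toSeq f k = modeVal c k * b k) : HasTrace u f := by
  -- A trace is defined through a sequence, so the net of finite sums is restricted to symmetric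
  -- partial sums.
  have hS : Tendsto (fun n : ℕ => Finset.Icc (-(n : ℤ)) n) atTop atTop := by
    refine tendsto_atTop_finset_of_monotone (fun m n hmn => ?_) fun k => ⟨k.natAbs, ?_⟩
    · exact Finset.Icc_subset_Icc (by omega) (by omega)
    · simp only [Finset.mem_Icc]; omega
  have hm := fun k => contDiff_mode c k
  refine (isTraceL2_iff _ _).2 ⟨fun n z => ∑ k ∈ Finset.Icc (-(n : ℤ)) n,
    b k / weight k * mode c k z, fun n => contDiff_sum_mul _ _ hm, ?_, fun j => ?_, ?_⟩
  · simp only [discL2_sum _ _ fun k => (hm k).continuous]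
    exact hu.comp hS
  · have e : ∀ n : ℕ, discL2 (pderiv j fun z => ∑ k ∈ Finset.Icc (-(n : ℤ)) n,
        b k / weight k * mode c k z) (contDiff_pderiv (contDiff_sum_mul _ _ hm)).continuous =
        ∑ k ∈ Finset.Icc (-(n : ℤ)) n, (b k / weight k) • (modeH1 c k).grad j := fun n => by
      rw [discL2_congr _ (contDiff_sum_mul _ _ fun k => contDiff_pderiv (j := j) (hm k)).continuous
        (pderiv_sum _ _ hm j), discL2_sum _ _ fun k => (contDiff_pderiv (hm k)).continuous]
      rfl
    simp only [e]
    exact (hg j).comp hS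
  · simp only [bdryL2_sum _ _ fun k => (hm k).continuous]
    have h := ((hasSum_fourierHalf f).mapL incl).comp hS
    refine h.congr fun n => ?_
    refine Finset.sum_congr rfl fun k _ => ?_
    beta_reduce
    rw [map_smul, incl_fourierHalf, bdryL2_mode, smul_smul, hf]
    congr 1
    ring

/-- For fixed `v` both sides expand into the same series, with terms given by `form_mode`; the
boundary terms add up to the ℓ² inner product that represents `ψ h`. -/
lemma form_of_hasSum_mode {γ lam : ℝ} (hc : 4 * c = γ - lam)
    (hu : HasSum (fun k => (b k / weight k) • (modeH1 c k).toL2) u.toL2)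
    (hg : ∀ j, HasSum (fun k => (b k / weight k) • (modeH1 c k).grad j) (u.grad j))
    {ψ : HMinusHalf}
    (hψ : ∀ k, HHalf.toSeq (riesz.symm ψ) k = 2 * Real.pi / weight k ^ 2 * (modeDeriv c k * b k))
    {v : H1} {h : HHalf} (hv : HasTrace v h) :
    form γ u v = inner ℂ v.toL2 ((lam : ℂ) • u.toL2) + ψ h := by
  have hL : HasSum (fun k => (b k / weight k) * form γ (modeH1 c k) v) (form γ u v) := by
    have h1 := (hasSum_sum (s := Finset.univ) fun j _ =>
      (hg j).mapL (innerSL ℂ (v.grad j))).add ((hu.mapL (innerSL ℂ v.toL2)).mul_left (γ : ℂ))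
    refine hasSum_of_eq h1 fun k => ?_
    simp only [form, map_smul, innerSL_apply_apply, smul_eq_mul, mul_add, Finset.mul_sum]
    ring
  have hR : HasSum (fun k => (b k / weight k) * form γ (modeH1 c k) v)
      (inner ℂ v.toL2 ((lam : ℂ) • u.toL2) + ψ h) := by
    have h1 := (hu.mapL (innerSL ℂ v.toL2)).mul_left (lam : ℂ)
    have h2 := lp.hasSum_inner (𝕜 := ℂ) (HHalf.toSeq h) (HHalf.toSeq (riesz.symm ψ))
    rw [← inner_HHalf, ← apply_eq_inner] at h2
    rw [inner_smul_right]
    refine hasSum_of_eq (h1.add h2) fun k => ?_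
    beta_reduce
    rw [form_mode hc k hv, inner_fourierL2_right, hψ, map_smul, innerSL_apply_apply, smul_eq_mul,
      RCLike.inner_apply]
    have := weight_ne_zero k
    field_simp
  exact hL.unique hR

end series

/-! ### Weak solutions and their Cauchy data. -/

lemma weakEq_of_form {γ : ℝ} {u : H1} {w : L2Disc}
    (h : ∀ v : H1, HasTrace v 0 → form γ u v = inner ℂ v.toL2 w) : WeakEq γ u w := by
  intro η hη
  have hc := hη.conj_comp.smooth
  -- The conjugate of a test function is an admissible element of H¹ with zero trace; the
  -- conjugation undoes the antilinearity of the form in its second argument.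
  have hz : bdryL2 _ hc.continuous = 0 := by
    refine Lp.ext ?_
    filter_upwards [coeFn_bdryL2 hc.continuous, Lp.coeFn_zero ℂ 2 (volume : Measure Bdry)]
      with θ h1 h2
    rw [h1, h2]
    exact hη.conj_comp.eq_zero (by simp [disc, bdryPoint, Circle.norm_coe])
  have ht := isTraceL2_ofSmooth _ hc
  rw [hz, ← map_zero incl] at ht
  have h1 := h _ ht
  have e : ∀ j, (H1.ofSmooth _ hc).grad j =
      discL2 _ (continuous_conj_comp (contDiff_pderiv (j := j) hη.smooth).continuous) := fun j =>
    discL2_congr (contDiff_pderiv hc).continuous _ (funext fun z => pderiv_conj)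
  rw [form] at h1
  simp only [e] at h1
  rw [setIntegral_mul_eq_inner _ hη.smooth.continuous,
    setIntegral_mul_eq_inner _ hη.smooth.continuous]
  simp only [fun j => setIntegral_mul_eq_inner (u.grad j)
      (contDiff_pderiv (j := j) hη.smooth).continuous]
  exact h1

/-- The fundamental lemma of the calculus of variations. It identifies the function `w` hidden in
`HasConormal` with `lam • u`. -/
lemma eq_of_weakEq {γ : ℝ} {u : H1} {w w' : L2Disc} (h : WeakEq γ u w) (h' : WeakEq γ u w') :
    w = w' := by
  have hw : Integrable (w - w' : L2Disc) (volume.restrict disc) :=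
    (Lp.memLp (w - w')).integrable (by norm_num)
  have h0 : ∀ᵐ z : ℂ, z ∈ disc → (w - w' : L2Disc) z = 0 := by
    refine Metric.isOpen_ball.ae_eq_zero_of_integral_contDiff_smul_eq_zero
      (IntegrableOn.locallyIntegrableOn hw) fun g hg hgc hgs => ?_
    have ht : IsTestFunction fun z => (g z : ℂ) := by
      have hsupp : tsupport (fun z => (g z : ℂ)) = tsupport g := by
        unfold tsupport
        congr 1
        ext z
        simp
      exact ⟨Complex.ofRealCLM.contDiff.comp hg, by rw [HasCompactSupport, hsupp]; exact hgc,
        by rw [hsupp]; exact hgs⟩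
    have hz : ∀ z, z ∉ disc → g z • (w - w' : L2Disc) z = 0 := fun z hz => by
      rw [image_eq_zero_of_notMem_tsupport fun h => hz (hgs h), zero_smul]
    rw [← setIntegral_eq_integral_of_forall_compl_eq_zero hz]
    have h1 := (h _ ht).symm.trans (h' _ ht)
    rw [setIntegral_mul_eq_inner _ ht.smooth.continuous,
      setIntegral_mul_eq_inner _ ht.smooth.continuous, ← sub_eq_zero, ← inner_sub_right,
      ← setIntegral_mul_eq_inner _ ht.smooth.continuous] at h1
    rw [← h1]
    refine integral_congr_ae (Eventually.of_forall fun z => ?_)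
    simp only [Complex.real_smul, mul_comm]
  rw [← sub_eq_zero]
  refine Lp.ext ?_
  filter_upwards [(ae_restrict_iff' measurableSet_disc).2 h0,
    Lp.coeFn_zero ℂ 2 (volume.restrict disc)] with z h1 h2
  rw [h1, h2]
  rfl

lemma conj_form (γ : ℝ) (u v : H1) : conj (form γ u v) = form γ v u := by
  simp [form]

/-- The Cauchy data of every solution satisfy the Dirichlet-to-Neumann relation. -/
lemma cauchy_data_relation {γ lam c : ℝ} (hc : 4 * c = γ - lam) {u : H1} {f : HHalf}
    {ψ : HMinusHalf} (hw : WeakEq γ u ((lam : ℂ) • u.toL2)) (hf : HasTrace u f)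
    (hψ : HasConormal γ u ψ) (k : ℤ) :
    modeVal c k * HHalf.toSeq (riesz.symm ψ) k =
      2 * Real.pi / weight k ^ 2 * (modeDeriv c k * HHalf.toSeq f k) := by
  obtain ⟨w, hw', hG⟩ := hψ
  obtain rfl := eq_of_weakEq hw' hw
  -- Green's identity is written once for `u` tested with the mode and once for the mode tested with
  -- `u`. The form is Hermitian and `lam` is real, so the interior terms cancel and only Cauchy data
  -- remain.
  have h1 := hG _ _ (hasTrace_mode c k)
  have h2 := congrArg conj (form_mode hc k hf)
  rw [conj_form, h1, ContinuousLinearMap.map_smulₛₗ, apply_fourierHalf, inner_fourierL2_right,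
    inner_smul_right] at h2
  simp only [map_add, map_mul, inner_conj_symm, Complex.conj_ofReal, map_div₀, Complex.conj_conj,
    map_ofNat, smul_eq_mul] at h2
  have := weight_ne_zero k
  field_simp at h2 ⊢
  linear_combination h2

/-- Every square summable sequence of coefficients gives a solution. -/
lemma exists_solution {γ lam c : ℝ} (hc : 4 * c = γ - lam) (b : lp (fun _ : ℤ => ℂ) 2)
    {f : HHalf} (hf : ∀ k, HHalf.toSeq f k = modeVal c k * b k) {ψ : HMinusHalf}
    (hψ : ∀ k, HHalf.toSeq (riesz.symm ψ) k =
      2 * Real.pi / weight k ^ 2 * (modeDeriv c k * b k)) :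
    ∃ u : H1, WeakEq γ u ((lam : ℂ) • u.toL2) ∧ HasTrace u f ∧ HasConormal γ u ψ := by
  obtain ⟨u, hu, hg⟩ := exists_hasSum_mode c b
  have hform := fun v h hv => form_of_hasSum_mode hc hu hg hψ (v := v) (h := h) hv
  have hweak : WeakEq γ u ((lam : ℂ) • u.toL2) := weakEq_of_form fun v hv => by
    rw [hform v 0 hv, map_zero, add_zero]
  exact ⟨u, hweak, hasTrace_of_hasSum_mode hu hg hf, _, hweak, hform⟩

/-- The separated solutions do not vanish. -/
lemma modeH1_ne_zero (c : ℝ) (k : ℤ) : (modeH1 c k).toL2 ≠ 0 := by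
  intro h0
  have h1 : mode c k =ᵐ[volume.restrict disc] fun _ => 0 := by
    have h2 := coeFn_discL2 (contDiff_mode c k).continuous
    have h3 : discL2 (mode c k) (contDiff_mode c k).continuous = 0 := h0
    rw [h3] at h2
    exact h2.symm.trans (Lp.coeFn_zero ℂ 2 _)
  have h2 := Measure.eqOn_open_of_ae_eq h1 Metric.isOpen_ball
    (contDiff_mode c k).continuous.continuousOn continuousOn_const
  -- On (0, 1) the angular factor is nonzero, so the radial factor must vanish there, against its
  -- value 1 at the origin.
  have h3 : ∀ x ∈ Set.Ioo (0 : ℝ) 1, besselG c k.natAbs (x * x) = 0 := by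
    intro x hx
    have hx1 : (x : ℂ) ∈ disc := by
      simp [disc, abs_of_pos hx.1, hx.2]
    have h4 : mode c k x = 0 := h2 hx1
    rw [mode, mul_eq_zero, Complex.normSq_ofReal] at h4
    rcases h4 with h4 | h4
    · have h5 := norm_angularCoord k x
      rw [pow_eq_zero_iff'.1 h4 |>.1] at h5
      rw [norm_zero, Complex.norm_real, Real.norm_of_nonneg hx.1.le] at h5
      exact absurd h5 hx.1.ne
    · exact_mod_cast h4
  have h4 : Tendsto (fun x : ℝ => besselG c k.natAbs (x * x)) (𝓝[>] 0) (𝓝 1) := by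
    have : Continuous fun x : ℝ => besselG c k.natAbs (x * x) :=
      (contDiff_besselG c k.natAbs).continuous.comp (continuous_id.mul continuous_id)
    have h5 := this.tendsto 0
    rw [mul_zero, besselG_zero] at h5
    exact h5.mono_left nhdsWithin_le_nhds
  have h5 : Tendsto (fun x : ℝ => besselG c k.natAbs (x * x)) (𝓝[>] 0) (𝓝 0) := by
    refine tendsto_const_nhds.congr' ?_
    filter_upwards [Ioo_mem_nhdsGT (zero_lt_one' ℝ)] with x hx
    rw [h3 x hx]
  exact one_ne_zero (tendsto_nhds_unique h4 h5)

end DiscRobin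

/-! ### Diagonal operators and Schatten classes -/

namespace DiscRobin

section diagonal

variable {ι : Type*}

lemma lp_norm_le_of_forall_norm_le {C : ℝ} (hC : 0 ≤ C) {f g : lp (fun _ : ι => ℂ) 2}
    (h : ∀ i, ‖f i‖ ≤ C * ‖g i‖) : ‖f‖ ≤ C * ‖g‖ := by
  have h1 : ‖f‖ ≤ ‖(C : ℂ) • g‖ := by
    refine lp.norm_mono (by norm_num) fun i => ?_
    rw [lp.coeFn_smul, Pi.smul_apply, norm_smul, Complex.norm_real, Real.norm_of_nonneg hC]
    exact h i
  rwa [norm_smul, Complex.norm_real, Real.norm_of_nonneg hC] at h1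

lemma memℓp_mul {d : ι → ℂ} {C : ℝ} (hd : ∀ i, ‖d i‖ ≤ C) (b : lp (fun _ : ι => ℂ) 2) :
    Memℓp (fun i => d i * b i) 2 := by
  refine ((lp.memℓp b).const_smul (𝕜 := ℂ) (C : ℂ)).mono' fun i => ?_
  rw [norm_mul, Pi.smul_apply, norm_smul, Complex.norm_real]
  gcongr
  exact (hd i).trans (Real.le_norm_self C)

/-- The diagonal operator on `ℓ²` with a bounded diagonal. -/
noncomputable def diagonalOp (d : ι → ℂ) {C : ℝ} (hd : ∀ i, ‖d i‖ ≤ C) :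
    lp (fun _ : ι => ℂ) 2 →L[ℂ] lp (fun _ : ι => ℂ) 2 :=
  LinearMap.mkContinuous
    { toFun := fun b => ⟨fun i => d i * b i, memℓp_mul hd b⟩
      map_add' := fun b b' => by
        ext i
        simp only [lp.coeFn_add, Pi.add_apply, mul_add]
      map_smul' := fun a b => by
        ext i
        simp only [lp.coeFn_smul, Pi.smul_apply, smul_eq_mul, RingHom.id_apply]
        ring }
    |C| fun b => lp_norm_le_of_forall_norm_le (abs_nonneg C) fun i => by
      change ‖d i * b i‖ ≤ _
      rw [norm_mul]
      gcongr
      exact (hd i).trans (le_abs_self C)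

lemma diagonalOp_apply (d : ι → ℂ) {C : ℝ} (hd : ∀ i, ‖d i‖ ≤ C) (b : lp (fun _ : ι => ℂ) 2)
    (i : ι) : diagonalOp d hd b i = d i * b i := rfl

variable {H : Type*} [NormedAddCommGroup H] [InnerProductSpace ℂ H]
  (U : H ≃ₗᵢ[ℂ] lp (fun _ : ι => ℂ) 2)

lemma inner_symm_single [DecidableEq ι] (i : ι) (x : H) :
    inner ℂ (U.symm (lp.single 2 i (1 : ℂ))) x = U x i := by
  rw [← U.inner_map_map, U.apply_symm_apply, lp.inner_single_left]
  simp

variable [CompleteSpace H] {A : H →L[ℂ] H} {d : ι → ℂ}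

/-- The truncations `F S` to finitely many coordinates have finite rank and converge to `A` in norm,
because the diagonal is small off a finite set. -/
lemma isCompactOperator_of_diagonal (hA : ∀ x i, U (A x) i = d i * U x i)
    (hd : Tendsto d cofinite (𝓝 0)) : IsCompactOperator A := by
  classical
  let e : ι → H := fun i => U.symm (lp.single 2 i (1 : ℂ))
  let F : Finset ι → H →L[ℂ] H := fun S => ∑ i ∈ S, d i • (innerSL ℂ (e i)).smulRight (e i)
  have hF : ∀ S, IsCompactOperator (F S) := by
    intro S
    induction S using Finset.induction_on with
    | empty => simp only [F, Finset.sum_empty]; exact isCompactOperator_zero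
    | insert i S hi ih =>
      simp only [F, Finset.sum_insert hi]
      refine IsCompactOperator.add (IsCompactOperator.smul ?_ _) ih
      exact (isCompactOperator_of_locallyCompactSpace_rng
        (ContinuousLinearMap.toSpanSingleton ℂ (e i))).comp_clm
          (innerSL ℂ (e i))
  have hFU : ∀ S x i, U (F S x) i = if i ∈ S then d i * U x i else 0 := by
    intro S x i
    have h : U (F S x) = ∑ j ∈ S, (d j * U x j) • lp.single 2 j (1 : ℂ) := by
      simp only [F, sum_apply, map_sum]
      refine Finset.sum_congr rfl fun j _ => ?_
      rw [smul_apply, ContinuousLinearMap.smulRight_apply, map_smul, map_smul,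
        innerSL_apply_apply, inner_symm_single, U.apply_symm_apply, smul_smul]
    rw [h, lp.coeFn_sum, Finset.sum_apply]
    simp only [lp.coeFn_smul, Pi.smul_apply, lp.coeFn_single, Pi.single_apply, smul_eq_mul,
      mul_ite, mul_one, mul_zero]
    rw [Finset.sum_ite_eq]
  refine isCompactOperator_of_tendsto (l := atTop) (F := F) ?_ (Eventually.of_forall hF)
  rw [Metric.tendsto_nhds]
  intro ε hε
  have hfin : {i | ¬ ‖d i‖ < ε / 2}.Finite := by
    have := (tendsto_zero_iff_norm_tendsto_zero.1 hd).eventually_lt_const (half_pos hε)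
    exact eventually_cofinite.1 this
  filter_upwards [eventually_ge_atTop hfin.toFinset] with S hS
  rw [dist_eq_norm, norm_sub_rev]
  refine lt_of_le_of_lt (ContinuousLinearMap.opNorm_le_bound _ (half_pos hε).le fun x => ?_)
    (half_lt_self hε)
  rw [← U.norm_map, ← U.norm_map x]
  refine lp_norm_le_of_forall_norm_le (half_pos hε).le fun i => ?_
  rw [sub_apply, map_sub, lp.coeFn_sub, Pi.sub_apply, hA, hFU]
  split_ifs with hi
  · rw [sub_self, norm_zero]
    positivity
  · rw [sub_zero, norm_mul]
    gcongr
    by_contra h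
    exact hi (hS (hfin.mem_toFinset.2 fun h' => h h'.le))

/-- Pair with the basis vector e_i: since A e_i = d_i e_i, the i-th coordinate of A*Ax is ⟨A e_i, A
x⟩. -/
lemma adjoint_comp_self_of_diagonal (hA : ∀ x i, U (A x) i = d i * U x i) (x : H) (i : ι) :
    U ((ContinuousLinearMap.adjoint A ∘L A) x) i = ((‖d i‖ ^ 2 : ℝ) : ℂ) * U x i := by
  classical
  have hs : A (U.symm (lp.single 2 i (1 : ℂ))) = d i • U.symm (lp.single 2 i (1 : ℂ)) := by
    apply U.injective
    ext j
    rw [hA, map_smul, U.apply_symm_apply, lp.coeFn_smul, Pi.smul_apply, lp.coeFn_single,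
      smul_eq_mul]
    by_cases h : j = i
    · subst h; rfl
    · simp [h]
  rw [← inner_symm_single, ContinuousLinearMap.comp_apply, ContinuousLinearMap.adjoint_inner_right,
    hs, inner_smul_left, inner_symm_single, hA, ← mul_assoc, Complex.conj_mul']
  push_cast
  rfl

/-- Eigenvectors of A*A for s² are exactly the vectors supported where ‖d_i‖ = s, so restricting
coordinates to that finite set is an isomorphism. -/
lemma finrank_eigenspace_of_diagonal (hA : ∀ x i, U (A x) i = d i * U x i)
    {s : ℝ} (hs : 0 < s) (hfin : Finite {i // ‖d i‖ = s}) :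
    Module.finrank ℂ (Module.End.eigenspace
        ((ContinuousLinearMap.adjoint A ∘L A : H →L[ℂ] H) : H →ₗ[ℂ] H) ((s ^ 2 : ℝ) : ℂ)) =
      Nat.card {i // ‖d i‖ = s} := by
  classical
  have := Fintype.ofFinite {i // ‖d i‖ = s}
  have hmem : ∀ x : H, x ∈ Module.End.eigenspace
        ((ContinuousLinearMap.adjoint A ∘L A : H →L[ℂ] H) : H →ₗ[ℂ] H) ((s ^ 2 : ℝ) : ℂ) ↔
      ∀ i, ‖d i‖ ≠ s → U x i = 0 := by
    intro x
    rw [Module.End.mem_eigenspace_iff, ContinuousLinearMap.coe_coe, ← U.injective.eq_iff]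
    constructor
    · intro h i hi
      have h1 : U ((ContinuousLinearMap.adjoint A ∘L A) x) i = U (((s ^ 2 : ℝ) : ℂ) • x) i := by
        rw [h]
      rw [adjoint_comp_self_of_diagonal U hA, map_smul, lp.coeFn_smul, Pi.smul_apply, smul_eq_mul,
        ← sub_eq_zero, ← sub_mul, ← Complex.ofReal_sub, mul_eq_zero] at h1
      refine h1.resolve_left fun h2 => hi ?_
      rw [Complex.ofReal_eq_zero, sub_eq_zero] at h2
      exact (sq_eq_sq₀ (norm_nonneg _) hs.le).1 h2
    · intro h
      ext i
      rw [adjoint_comp_self_of_diagonal U hA, map_smul, lp.coeFn_smul, Pi.smul_apply, smul_eq_mul]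
      by_cases hi : ‖d i‖ = s
      · rw [hi]
      · rw [h i hi, mul_zero, mul_zero]
  let T : Module.End.eigenspace
        ((ContinuousLinearMap.adjoint A ∘L A : H →L[ℂ] H) : H →ₗ[ℂ] H) ((s ^ 2 : ℝ) : ℂ) →ₗ[ℂ]
      ({i // ‖d i‖ = s} → ℂ) :=
    { toFun := fun x i => U (x : H) i
      map_add' := fun x y => by
        funext i
        simp only [Submodule.coe_add, map_add, lp.coeFn_add, Pi.add_apply]
      map_smul' := fun a x => by
        funext i
        simp only [Submodule.coe_smul, map_smul, lp.coeFn_smul, Pi.smul_apply, RingHom.id_apply] }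
  have hT : Function.Bijective T := by
    constructor
    · rw [injective_iff_map_eq_zero]
      intro x hx
      have h0 : U (x : H) = 0 := by
        ext i
        by_cases hi : ‖d i‖ = s
        · exact congrFun hx ⟨i, hi⟩
        · exact (hmem x).1 x.2 i hi
      exact Subtype.ext ((map_eq_zero_iff U U.injective).1 h0)
    · intro g
      let y : lp (fun _ : ι => ℂ) 2 :=
        ∑ k : {i // ‖d i‖ = s}, lp.single 2 (k : ι) (g k)
      have hy : ∀ i, y i = ∑ k : {i // ‖d i‖ = s}, if i = (k : ι) then g k else 0 := by
        intro i
        simp only [y, lp.coeFn_sum, Finset.sum_apply, lp.coeFn_single, Pi.single_apply]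
      refine ⟨⟨U.symm y, (hmem _).2 fun i hi => ?_⟩, ?_⟩
      · rw [U.apply_symm_apply, hy]
        exact Finset.sum_eq_zero fun k _ => if_neg fun h => hi ((congrArg (fun i => ‖d i‖) h).trans k.2)
      · funext i
        change U (U.symm y) i = g i
        rw [U.apply_symm_apply, hy, Finset.sum_eq_single i (fun k _ hk => if_neg fun h =>
          hk (Subtype.ext h.symm)) (by simp), if_pos rfl]
  rw [(LinearEquiv.ofBijective T hT).finrank_eq, Module.finrank_fintype_fun_eq_card,
    Nat.card_eq_fintype_card]

/-- A diagonal operator with null diagonal `d` is in the Schatten class `B_p` if and only if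
`∑ |dᵢ|^p < ∞`. -/
theorem isSchatten_iff_of_diagonal (hA : ∀ x i, U (A x) i = d i * U x i)
    (hd : Tendsto d cofinite (𝓝 0)) {p : ℝ} (hp : 0 < p) :
    IsSchatten p A ↔ Summable fun i => ‖d i‖ ^ p := by
  have hfin : ∀ s : ℝ, 0 < s → Finite {i // ‖d i‖ = s} := by
    intro s hs
    have h := eventually_cofinite.1
      ((tendsto_zero_iff_norm_tendsto_zero.1 hd).eventually_lt_const hs)
    exact (h.subset fun i (hi : ‖d i‖ = s) => by simp [hi]).to_subtype
  rw [IsSchatten, and_iff_right (isCompactOperator_of_diagonal U hA hd)]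
  -- Vanishing entries contribute 0^p = 0 and are dropped. The remaining indices are grouped by the
  -- value of ‖d_i‖: each fibre is finite and contributes its cardinality times s^p, which is the
  -- multiplicity count in `IsSchatten`.
  let K := {i // 0 < ‖d i‖}
  let π : K → Set.Ioi (0 : ℝ) := fun i => ⟨‖d i‖, i.2⟩
  have e1 : (Summable fun i => ‖d i‖ ^ p) ↔ Summable fun i : K => ‖d i‖ ^ p := by
    refine (Subtype.val_injective.summable_iff fun i hi => ?_).symm
    have : ‖d i‖ = 0 := by
      by_contra h
      exact hi ⟨⟨i, (norm_nonneg _).lt_of_ne' h⟩, rfl⟩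
    rw [this, Real.zero_rpow hp.ne']
  have e2 : ∀ s : Set.Ioi (0 : ℝ), Nonempty ({i : K // π i = s} ≃ {i // ‖d i‖ = s}) := fun s =>
    ⟨{ toFun := fun i => ⟨i.1.1, congrArg Subtype.val i.2⟩
       invFun := fun i => ⟨⟨i.1, by rw [i.2]; exact s.2⟩, Subtype.ext i.2⟩
       left_inv := fun i => rfl
       right_inv := fun i => rfl }⟩
  have hfin' : ∀ s : Set.Ioi (0 : ℝ), Finite {i : K // π i = s} := fun s =>
    have := hfin s s.2
    Finite.of_equiv _ (e2 s).some.symm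
  rw [e1, ← (Equiv.sigmaFiberEquiv π).summable_iff,
    summable_sigma_of_nonneg (f := (fun i : K => ‖d i‖ ^ p) ∘ Equiv.sigmaFiberEquiv π)
      fun _ => Real.rpow_nonneg (norm_nonneg _) p]
  rw [and_iff_right fun s => by
    have := hfin' s
    exact Summable.of_finite]
  refine summable_congr fun s => ?_
  have hs : (0 : ℝ) < s := s.2
  have := hfin s hs
  have := hfin' s
  have h1 : ∀ i : {i : K // π i = s},
      ((fun i : K => ‖d i‖ ^ p) ∘ Equiv.sigmaFiberEquiv π) ⟨s, i⟩ = (s : ℝ) ^ p := fun i => by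
    have : ‖d i.1.1‖ = s := congrArg Subtype.val i.2
    simp only [Function.comp, Equiv.sigmaFiberEquiv_apply, this]
  simp only [h1]
  have := Fintype.ofFinite {i : K // π i = s}
  rw [finrank_eigenspace_of_diagonal U hA hs (hfin s hs), tsum_fintype, Finset.sum_const,
    Finset.card_univ, nsmul_eq_mul, ← Nat.card_eq_fintype_card, Nat.card_congr (e2 s).some]

end diagonal

/-! ### Summability over the integers. -/

lemma tendsto_natAbs_cofinite : Tendsto (fun k : ℤ => (k.natAbs : ℝ)) cofinite atTop := by
  refine tendsto_natCast_atTop_atTop.comp (tendsto_atTop.2 fun n => ?_)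
  refine eventually_cofinite.2 ((Set.finite_Icc (-(n : ℤ)) n).subset fun k hk => ?_)
  simp only [Set.mem_ofPred_eq, Set.mem_Icc] at hk ⊢
  omega

lemma summable_natAbs_rpow_iff {p : ℝ} : (Summable fun k : ℤ => ((k.natAbs : ℝ) ^ p)⁻¹) ↔ 1 < p := by
  rw [← Real.summable_nat_rpow_inv]
  constructor
  · intro h
    have h1 := h.comp_injective (Nat.cast_injective (R := ℤ))
    simpa only [Function.comp_def, Int.natAbs_natCast] using h1
  · intro h
    exact Summable.of_nat_of_neg (by simpa only [Int.natAbs_natCast] using h)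
      (by simpa only [Int.natAbs_neg, Int.natAbs_natCast] using h)

/-- Off a finite set, |k|‖d_k‖ lies between ‖L‖/2 and ‖L‖ + 1, so both directions are comparisons
with |k|^{-p}. -/
lemma summable_norm_rpow_iff {d : ℤ → ℂ} {L : ℂ} (hL : L ≠ 0)
    (hd : Tendsto (fun k : ℤ => (k.natAbs : ℂ) * d k) cofinite (𝓝 L)) {p : ℝ} (hp : 0 < p) :
    (Summable fun k => ‖d k‖ ^ p) ↔ 1 < p := by
  have hL' : 0 < ‖L‖ := norm_pos_iff.2 hL
  have h1 := hd.norm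
  have h2 : ∀ᶠ k : ℤ in cofinite, (0 : ℝ) < k.natAbs := tendsto_natAbs_cofinite.eventually_gt_atTop 0
  simp only [norm_mul, Complex.norm_natCast] at h1
  rw [← summable_natAbs_rpow_iff]
  constructor
  · intro h
    refine (h.mul_left ((‖L‖ / 2) ^ p)⁻¹).of_norm_bounded_eventually ?_
    filter_upwards [h2, h1.eventually_const_lt (half_lt_self hL')] with k hk h3
    rw [Real.norm_of_nonneg (by positivity), ← div_eq_inv_mul, inv_eq_one_div,
      div_le_div_iff₀ (by positivity) (by positivity), one_mul, mul_comm,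
      ← Real.mul_rpow hk.le (norm_nonneg _)]
    gcongr
  · intro h
    refine (h.mul_left ((‖L‖ + 1) ^ p)).of_norm_bounded_eventually ?_
    filter_upwards [h2, h1.eventually_lt_const (lt_add_one ‖L‖)] with k hk h3
    rw [Real.norm_of_nonneg (by positivity), ← div_eq_mul_inv, le_div_iff₀ (by positivity), mul_comm,
      ← Real.mul_rpow hk.le (norm_nonneg _)]
    gcongr

end DiscRobin

/-! ### Asymptotics of the Robin symbols -/

namespace DiscRobin

lemma tendsto_inv_natAbs_add_one :
    Tendsto (fun k : ℤ => ((k.natAbs : ℝ) + 1)⁻¹) cofinite (𝓝 0) :=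
  tendsto_inv_atTop_zero.comp (tendsto_atTop_add_const_right _ 1 tendsto_natAbs_cofinite)

lemma tendsto_modeVal (c : ℝ) : Tendsto (modeVal c) cofinite (𝓝 1) := by
  rw [tendsto_iff_norm_sub_tendsto_zero]
  have h := tendsto_inv_natAbs_add_one.const_mul (|c| * Real.exp |c|)
  rw [mul_zero] at h
  exact squeeze_zero (fun k => norm_nonneg _)
    (fun k => (abs_besselG_sub_one_le c k.natAbs).trans_eq (div_eq_mul_inv _ _)) h

/-- The difference is the radial term 2G'(1), which is O(1/|k|). It is this o(1) precision, not
merely D_k ~ |k|, that lets the leading terms cancel in `E - I`. -/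
lemma tendsto_modeDeriv_sub (c : ℝ) :
    Tendsto (fun k => modeDeriv c k - k.natAbs * modeVal c k) cofinite (𝓝 0) := by
  have h := tendsto_inv_natAbs_add_one.const_mul (2 * |c| * Real.exp |c|)
  rw [mul_zero] at h
  refine squeeze_zero_norm (fun k => ?_) h
  have h1 := abs_besselG_le_exp c (k.natAbs + 1) zero_le_one le_rfl
  have h2 : modeDeriv c k - k.natAbs * modeVal c k =
      2 * c * besselG c (k.natAbs + 1) 1 * ((k.natAbs : ℝ) + 1)⁻¹ := by
    rw [modeDeriv, modeVal]; ring
  rw [h2, norm_mul, norm_mul, norm_mul, Real.norm_two, Real.norm_eq_abs, Real.norm_eq_abs,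
    Real.norm_of_nonneg (by positivity)]
  gcongr

lemma tendsto_natAbs_div_weight_sq :
    Tendsto (fun k : ℤ => (k.natAbs : ℝ) / weight k ^ 2) cofinite (𝓝 1) := by
  have h : Tendsto (fun k : ℤ => 1 - ((k.natAbs : ℝ) + 1)⁻¹) cofinite (𝓝 1) := by
    simpa using tendsto_inv_natAbs_add_one.const_sub 1
  refine tendsto_of_tendsto_of_tendsto_of_le_of_le h tendsto_const_nhds (fun k => ?_) fun k => ?_
  · have hk : (0 : ℝ) < (k.natAbs : ℝ) + 1 := by positivity
    have e : 1 - ((k.natAbs : ℝ) + 1)⁻¹ = k.natAbs / ((k.natAbs : ℝ) + 1) := by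
      field_simp
      ring
    rw [e]
    have := weight_positive k
    exact div_le_div_of_nonneg_left (by positivity) (by positivity) (weight_sq_le k)
  · exact (div_le_one (pow_pos (weight_positive k) 2)).2 (natAbs_le_weight_sq k)

/-- The normalized Robin data of `mode c k`. -/
noncomputable def robinSymbol (c : ℝ) (μ : ℂ) (k : ℤ) : ℂ :=
  (modeDeriv c k + μ * modeVal c k) / weight k ^ 2

lemma tendsto_inv_weight_sq : Tendsto (fun k : ℤ => (weight k ^ 2)⁻¹) cofinite (𝓝 0) :=
  tendsto_inv_atTop_zero.comp (tendsto_atTop_mono natAbs_le_weight_sq tendsto_natAbs_cofinite)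

lemma tendsto_modeVal_complex (c : ℝ) :
    Tendsto (fun k => (modeVal c k : ℂ)) cofinite (𝓝 1) := by
  simpa using (tendsto_modeVal c).ofReal

/-- D_k grows like |k|, hence like w_k², while μF_k stays bounded. The limit 1 makes the multipliers
of the two boundary maps bounded. -/
lemma tendsto_robinSymbol (c : ℝ) (μ : ℂ) : Tendsto (robinSymbol c μ) cofinite (𝓝 1) := by
  have h1 : Tendsto (fun k => (modeDeriv c k - k.natAbs * modeVal c k) * (weight k ^ 2)⁻¹ +
      k.natAbs / weight k ^ 2 * modeVal c k) cofinite (𝓝 (0 * 0 + 1 * 1)) :=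
    ((tendsto_modeDeriv_sub c).mul tendsto_inv_weight_sq).add
      (tendsto_natAbs_div_weight_sq.mul (tendsto_modeVal c))
  have h2 := ((tendsto_modeVal_complex c).const_mul μ).mul tendsto_inv_weight_sq.ofReal
  have h3 := h1.ofReal.add h2
  simp only [mul_zero, zero_add, add_zero, Complex.ofReal_one, mul_one,
    Complex.ofReal_zero] at h3
  refine h3.congr fun k => ?_
  rw [robinSymbol]
  push_cast
  ring

lemma exists_norm_le_of_tendsto_cofinite {ι : Type*} {d : ι → ℂ} {L : ℂ}
    (h : Tendsto d cofinite (𝓝 L)) : ∃ C, ∀ k, ‖d k‖ ≤ C := by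
  obtain ⟨C, hC⟩ := h.norm.bddAbove_range_of_cofinite
  exact ⟨C, fun k => hC ⟨k, rfl⟩⟩

/-- The leading asymptotics of the diagonal of `E(λ) - I`. -/
lemma tendsto_natAbs_mul_sub_one {c c' : ℝ} {μ μ' : ℂ} (hF : ∀ k, modeVal c' k ≠ 0)
    (hq : ∀ k, robinSymbol c μ k ≠ 0) :
    Tendsto (fun k : ℤ => (k.natAbs : ℂ) * (2 * Real.pi * robinSymbol c' μ' k / modeVal c' k *
      (modeVal c k * (2 * Real.pi * robinSymbol c μ k)⁻¹) - 1)) cofinite (𝓝 (μ' - μ)) := by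
  have h1 := tendsto_modeVal_complex c
  have h1' := tendsto_modeVal_complex c'
  have h2 := (tendsto_modeDeriv_sub c).ofReal
  have h2' := (tendsto_modeDeriv_sub c').ofReal
  have h3 := tendsto_natAbs_div_weight_sq.ofReal
  have h4 := tendsto_robinSymbol c μ
  -- The numerator F(D' + μ'F') - F'(D + μF) is rewritten as F(D' - |k|F') - F'(D - |k|F) + (μ' -
  -- μ)FF', where the terms |k|FF' have cancelled and every piece has a limit.
  have h := (h3.mul ((((h2'.mul h1).sub (h2.mul h1'))).add
    ((h1.mul h1').const_mul (μ' - μ)))).div (h4.mul h1') (by norm_num)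
  simp only [Complex.ofReal_zero, sub_zero, zero_add, mul_one, Complex.ofReal_one,
    one_mul, div_one] at h
  refine h.congr fun k => ?_
  have e1 : (modeVal c' k : ℂ) ≠ 0 := Complex.ofReal_ne_zero.2 (hF k)
  have e2 := hq k
  have e3 := weight_ne_zero k
  have e4 : (Real.pi : ℂ) ≠ 0 := Complex.ofReal_ne_zero.2 Real.pi_ne_zero
  have e5 : robinSymbol c μ k * weight k ^ 2 = modeDeriv c k + μ * modeVal c k := by
    rw [robinSymbol, div_mul_cancel₀ _ (pow_ne_zero 2 e3)]
  have e6 : robinSymbol c' μ' k * weight k ^ 2 = modeDeriv c' k + μ' * modeVal c' k := by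
    rw [robinSymbol, div_mul_cancel₀ _ (pow_ne_zero 2 e3)]
  simp only [Pi.div_apply]
  push_cast
  field_simp
  linear_combination (k.natAbs : ℂ) * modeVal c' k * e5 - (k.natAbs : ℂ) * modeVal c k * e6

/-! ### The Robin-to-Dirichlet and Dirichlet-to-Robin maps in Fourier coordinates -/

lemma HHalf.ext_toSeq {f g : HHalf} (h : ∀ k, HHalf.toSeq f k = HHalf.toSeq g k) : f = g :=
  HHalf.injective_toSeq (lp.ext (funext h))

lemma HMinusHalf.ext_toSeq {φ ψ : HMinusHalf}
    (h : ∀ k, HHalf.toSeq (riesz.symm φ) k = HHalf.toSeq (riesz.symm ψ) k) : φ = ψ :=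
  riesz.symm.injective (HHalf.ext_toSeq h)

lemma toSeq_riesz_symm_add_smul (ψ : HMinusHalf) (μ : ℂ) (f : HHalf) (k : ℤ) :
    HHalf.toSeq (riesz.symm (ψ + (μ • inclJ) f)) k =
      HHalf.toSeq (riesz.symm ψ) k + μ * (2 * Real.pi / weight k ^ 2 * HHalf.toSeq f k) := by
  rw [map_add, smul_apply, map_smul, map_add, map_smul, lp.coeFn_add, lp.coeFn_smul,
    Pi.add_apply, Pi.smul_apply, smul_eq_mul, toSeq_inclJ]

/-- If the boundary value vanished, the mode would be a Dirichlet eigenfunction for `lam`; the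
resolvent would then force it to be R 0 = 0. -/
lemma modeVal_ne_zero {γ lam c : ℝ} (hc : 4 * c = γ - lam)
    (hM : InResolventSet (dirichletGraph γ) (lam : ℂ)) (k : ℤ) : modeVal c k ≠ 0 := by
  intro h0
  obtain ⟨R, hR⟩ := hM
  refine modeH1_ne_zero c k (((hR (modeH1 c k).toL2 0).1 ⟨modeH1 c k, rfl, ?_, fun v hv => ?_⟩).trans
    (map_zero R))
  · have h := hasTrace_mode c k
    rwa [h0, Complex.ofReal_zero, zero_smul] at h
  · rw [form_mode hc k hv, map_zero, inner_zero_left, mul_zero, add_zero, zero_add,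
      inner_smul_right]

/-- If the symbol vanished, the mode would satisfy the homogeneous Robin condition and be an
eigenfunction for `lam`. -/
lemma robinSymbol_ne_zero {γ lam c : ℝ} {μ : ℂ} (hc : 4 * c = γ - lam)
    (hN : InResolventSet (robinGraph γ (μ • inclJ)) (lam : ℂ)) (k : ℤ) :
    robinSymbol c μ k ≠ 0 := by
  intro h0
  have h1 : (modeDeriv c k + μ * modeVal c k : ℂ) = 0 :=
    (div_eq_zero_iff.1 h0).resolve_right (pow_ne_zero 2 (weight_ne_zero k))
  obtain ⟨R, hR⟩ := hN
  refine modeH1_ne_zero c k (((hR (modeH1 c k).toL2 0).1 ⟨modeH1 c k, _, rfl, hasTrace_mode c k,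
    fun v h hv => ?_⟩).trans (map_zero R))
  rw [form_mode hc k hv, smul_apply, map_smul, smul_apply, smul_apply, inclJ_apply,
    incl_fourierHalf, smul_eq_mul, smul_eq_mul, zero_add, inner_smul_right]
  linear_combination inner ℂ (incl h) (fourierL2 k) * h1

lemma exists_robinToDirichlet {γ lam c : ℝ} {μ : ℂ} (hc : 4 * c = γ - lam)
    (hq : ∀ k, robinSymbol c μ k ≠ 0) :
    ∃ N : HMinusHalf →L[ℂ] HHalf, IsRobinToDirichlet γ (μ • inclJ) (lam : ℂ) N ∧
      ∀ g k, HHalf.toSeq (N g) k =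
        modeVal c k * (2 * Real.pi * robinSymbol c μ k)⁻¹ * HHalf.toSeq (riesz.symm g) k := by
  have hpi : (Real.pi : ℂ) ≠ 0 := Complex.ofReal_ne_zero.2 Real.pi_ne_zero
  have hlim : Tendsto (fun k => (2 * Real.pi * robinSymbol c μ k)⁻¹) cofinite
      (𝓝 (2 * Real.pi * 1)⁻¹) :=
    ((tendsto_robinSymbol c μ).const_mul _).inv₀ (by simp [hpi])
  obtain ⟨C, hC⟩ := exists_norm_le_of_tendsto_cofinite hlim
  obtain ⟨C', hC'⟩ := exists_norm_le_of_tendsto_cofinite ((tendsto_modeVal_complex c).mul hlim)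
  let N : HMinusHalf →L[ℂ] HHalf :=
    (HHalf.equivSeq.symm.toContinuousLinearEquiv : _ →L[ℂ] HHalf) ∘L diagonalOp _ hC' ∘L
      (HHalf.equivSeq.toContinuousLinearEquiv : HHalf →L[ℂ] _) ∘L
      (riesz.symm.toContinuousLinearEquiv : HMinusHalf →L[ℂ] HHalf)
  have hNs : ∀ g k, HHalf.toSeq (N g) k =
      modeVal c k * (2 * Real.pi * robinSymbol c μ k)⁻¹ * HHalf.toSeq (riesz.symm g) k :=
    fun g k => by
      have h : HHalf.equivSeq (N g) = diagonalOp _ hC' (HHalf.equivSeq (riesz.symm g)) :=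
        HHalf.equivSeq.apply_symm_apply _
      change HHalf.equivSeq (N g) k = _
      rw [h, diagonalOp_apply]
      rfl
  refine ⟨N, fun g f => ⟨?_, ?_⟩, hNs⟩
  · rintro rfl
    -- The solution has coefficients b_k = g_k/(2πq_k), chosen from the Robin data rather than from
    -- the trace since F_k may vanish here.
    have hψ : ∀ k, HHalf.toSeq (riesz.symm (g - (μ • inclJ) (N g))) k = 2 * Real.pi / weight k ^ 2 *
        (modeDeriv c k * diagonalOp _ hC (HHalf.toSeq (riesz.symm g)) k) := fun k => by
      have h := toSeq_riesz_symm_add_smul (g - (μ • inclJ) (N g)) μ (N g) k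
      rw [sub_add_cancel, hNs] at h
      rw [diagonalOp_apply]
      have e2 := hq k
      have e3 := weight_ne_zero k
      have e5 : robinSymbol c μ k * weight k ^ 2 = modeDeriv c k + μ * modeVal c k := by
        rw [robinSymbol, div_mul_cancel₀ _ (pow_ne_zero 2 e3)]
      rw [eq_comm, ← eq_sub_iff_add_eq] at h
      rw [h]
      field_simp
      linear_combination HHalf.toSeq (riesz.symm g) k * e5
    obtain ⟨u, h1, h2, h3⟩ := exists_solution hc (diagonalOp _ hC (HHalf.toSeq (riesz.symm g)))
      (f := N g) (fun k => by rw [hNs, diagonalOp_apply, mul_assoc]) hψ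
    exact ⟨u, _, h1, h2, h3, sub_add_cancel _ _⟩
  · rintro ⟨u, ψ, h1, h2, h3, rfl⟩
    refine HHalf.ext_toSeq fun k => ?_
    -- Adding the Robin term to this relation gives F_k g_k = 2πq_k f_k, which determines f because
    -- q_k ≠ 0.
    have h := cauchy_data_relation hc h1 h2 h3 k
    rw [hNs, toSeq_riesz_symm_add_smul]
    have e2 := hq k
    have e3 := weight_ne_zero k
    have e5 : robinSymbol c μ k * weight k ^ 2 = modeDeriv c k + μ * modeVal c k := by
      rw [robinSymbol, div_mul_cancel₀ _ (pow_ne_zero 2 e3)]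
    field_simp at h ⊢
    linear_combination h - 2 * Real.pi * HHalf.toSeq f k * e5

lemma exists_dirichletToRobin {γ lam c : ℝ} (μ : ℂ) (hc : 4 * c = γ - lam)
    (hF : ∀ k, modeVal c k ≠ 0) :
    ∃ M : HHalf →L[ℂ] HMinusHalf, IsDirichletToRobin γ (μ • inclJ) (lam : ℂ) M ∧
      ∀ f k, HHalf.toSeq (riesz.symm (M f)) k =
        2 * Real.pi * robinSymbol c μ k / modeVal c k * HHalf.toSeq f k := by
  have hF' : ∀ k, (modeVal c k : ℂ) ≠ 0 := fun k => Complex.ofReal_ne_zero.2 (hF k)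
  obtain ⟨C, hC⟩ := exists_norm_le_of_tendsto_cofinite
    ((tendsto_modeVal_complex c).inv₀ one_ne_zero)
  obtain ⟨C', hC'⟩ := exists_norm_le_of_tendsto_cofinite
    (((tendsto_robinSymbol c μ).const_mul (2 * Real.pi : ℂ)).div (tendsto_modeVal_complex c)
      one_ne_zero)
  let M : HHalf →L[ℂ] HMinusHalf :=
    (riesz.toContinuousLinearEquiv : HHalf →L[ℂ] HMinusHalf) ∘L
      (HHalf.equivSeq.symm.toContinuousLinearEquiv : _ →L[ℂ] HHalf) ∘L diagonalOp _ hC' ∘L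
      (HHalf.equivSeq.toContinuousLinearEquiv : HHalf →L[ℂ] _)
  have hMs : ∀ f k, HHalf.toSeq (riesz.symm (M f)) k =
        2 * Real.pi * robinSymbol c μ k / modeVal c k * HHalf.toSeq f k :=
    fun f k => by
      have h0 : riesz.symm (M f) = HHalf.equivSeq.symm (diagonalOp _ hC' (HHalf.equivSeq f)) :=
        riesz.symm_apply_apply _
      have h : HHalf.equivSeq (riesz.symm (M f)) = diagonalOp _ hC' (HHalf.equivSeq f) := by
        rw [h0, LinearIsometryEquiv.apply_symm_apply]
      change HHalf.equivSeq (riesz.symm (M f)) k = _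
      rw [h, diagonalOp_apply]
      rfl
  refine ⟨M, fun f g => ⟨?_, ?_⟩, hMs⟩
  · rintro rfl
    -- Here the trace fixes the coefficients, b_k = f_k/F_k; this sequence is square summable
    -- because F_k → 1 keeps the inverses bounded.
    have hψ : ∀ k, HHalf.toSeq (riesz.symm (M f - (μ • inclJ) f)) k = 2 * Real.pi / weight k ^ 2 *
        (modeDeriv c k * diagonalOp _ hC (HHalf.toSeq f) k) := fun k => by
      have h := toSeq_riesz_symm_add_smul (M f - (μ • inclJ) f) μ f k
      rw [sub_add_cancel, hMs] at h
      rw [diagonalOp_apply]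
      have e2 := hF' k
      have e3 := weight_ne_zero k
      have e5 : robinSymbol c μ k * weight k ^ 2 = modeDeriv c k + μ * modeVal c k := by
        rw [robinSymbol, div_mul_cancel₀ _ (pow_ne_zero 2 e3)]
      rw [eq_comm, ← eq_sub_iff_add_eq] at h
      rw [h]
      field_simp
      linear_combination HHalf.toSeq f k * e5
    obtain ⟨u, h1, h2, h3⟩ := exists_solution hc (diagonalOp _ hC (HHalf.toSeq f))
      (f := f) (fun k => by rw [diagonalOp_apply, mul_inv_cancel_left₀ (hF' k)]) hψ
    exact ⟨u, _, h1, h2, h3, sub_add_cancel _ _⟩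
  · rintro ⟨u, ψ, h1, h2, h3, rfl⟩
    refine HMinusHalf.ext_toSeq fun k => ?_
    have h := cauchy_data_relation hc h1 h2 h3 k
    rw [hMs, toSeq_riesz_symm_add_smul]
    have e2 := hF' k
    have e3 := weight_ne_zero k
    have e5 : robinSymbol c μ k * weight k ^ 2 = modeDeriv c k + μ * modeVal c k := by
      rw [robinSymbol, div_mul_cancel₀ _ (pow_ne_zero 2 e3)]
    field_simp at h ⊢
    linear_combination -h + 2 * Real.pi * HHalf.toSeq f k * e5

end DiscRobin

open DiscRobin
theorem theorem3p3 (γ lam : ℝ) (μ μ' : ℂ) (hlam : max γ 0 < lam) (hμ : μ ≠ μ')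
    (hN : InResolventSet (robinGraph 0 (μ • inclJ)) (lam : ℂ))
    (hM : InResolventSet (dirichletGraph γ) (lam : ℂ)) :
    ∃ (N : HMinusHalf →L[ℂ] HHalf) (M : HHalf →L[ℂ] HMinusHalf),
      IsRobinToDirichlet 0 (μ • inclJ) (lam : ℂ) N ∧
      IsDirichletToRobin γ (μ' • inclJ) (lam : ℂ) M ∧
      ∀ p : ℝ, 0 < p →
        (IsSchatten (H := HMinusHalf) p (M ∘L N - ContinuousLinearMap.id ℂ HMinusHalf) ↔ 1 < p) := by
  have hc : 4 * (-lam / 4) = 0 - lam := by ring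
  have hc' : 4 * ((γ - lam) / 4) = γ - lam := by ring
  have hq := robinSymbol_ne_zero hc hN
  have hF := modeVal_ne_zero hc' hM
  obtain ⟨N, hN1, hN2⟩ := exists_robinToDirichlet hc hq
  obtain ⟨M, hM1, hM2⟩ := exists_dirichletToRobin μ' hc' hF
  refine ⟨N, M, hN1, hM1, fun p hp => ?_⟩
  have hlim := tendsto_natAbs_mul_sub_one (μ' := μ') hF hq
  set d : ℤ → ℂ := fun k => 2 * Real.pi * robinSymbol ((γ - lam) / 4) μ' k /
    modeVal ((γ - lam) / 4) k * (modeVal (-lam / 4) k *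
      (2 * Real.pi * robinSymbol (-lam / 4) μ k)⁻¹) - 1 with hd
  -- Divide the convergent |k|d_k by |k|, away from k = 0.
  have hd0 : Tendsto d cofinite (𝓝 0) := by
    have h := hlim.mul (tendsto_inv_atTop_zero.comp tendsto_natAbs_cofinite).ofReal
    rw [Complex.ofReal_zero, mul_zero] at h
    refine h.congr' ?_
    filter_upwards [tendsto_natAbs_cofinite.eventually_gt_atTop 0] with k hk
    have hk' : (k.natAbs : ℂ) ≠ 0 := by exact_mod_cast hk.ne'
    simp only [Function.comp, Complex.ofReal_inv, Complex.ofReal_natCast]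
    rw [mul_comm, inv_mul_cancel_left₀ hk']
  -- The inverse Riesz map followed by weighted Fourier coefficients is a unitary map of H^{-1/2}
  -- onto ℓ²(ℤ) that makes `M ∘L N - I` diagonal.
  rw [isSchatten_iff_of_diagonal (riesz.symm.trans HHalf.equivSeq) (d := d) (fun x k => ?_) hd0 hp]
  · exact summable_norm_rpow_iff (sub_ne_zero.2 hμ.symm) hlim hp
  · change HHalf.toSeq (riesz.symm (M (N x) - x)) k = d k * HHalf.toSeq (riesz.symm x) k
    rw [riesz.symm.map_sub, map_sub, lp.coeFn_sub, Pi.sub_apply, hM2, hN2]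
    ring
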